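/- Let $\mathcal K(G)=\operatorname{diag}(G)e^T+e\operatorname{diag}(G)^T-2G$, where $e$ is the all-ones vector. For a symmetric hollow matrix $\bar D$ let $f(P)=\tfrac12\|\mathcal K(PP^T)-\bar D\|_F^2$ for $P\in\mathbb R^{n\times d}$ (half of the smooth stress), and $f_L(L)=f(VL)$ for $L\in\mathbb R^{(n-1)\times d}$, where $V\in\mathbb R^{n\times(n-1)}$ satisfies $V^TV=I$, $V^Te=0$. Configurations carry the Frobenius inner product, Hessians the operator norm; $B_r(\tilde L)$ is the open ball. A lngm is a local minimizer that is not a global minimizer. **(A)** Let $\bar P\in\mathbb R^{n\times d}$ with $\bar P^Te=0$, $\bar D=\mathcal K(\bar P\bar P^T)$, and $\tilde L\in\mathbb R^{(n-1)\times d}$. Let $r,\bar f_L,\gamma>0$ be such that for all $L,L'\in B_r(\tilde L)$: $\nabla^2 f_L(L)\succ0$, $f_L(L)>\bar f_L$, and $\|\nabla^2f_L(L)-\nabla^2f_L(L')\|\le\gamma\|L-L'\|$. Put $$\beta=\|\nabla^2f_L(\tilde L)^{-1}\|,\quad \eta=\|\nabla^2f_L(\tilde L)^{-1}\nabla f_L(\tilde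 L)\|,\quad \alpha=\beta\gamma\eta,\quad r_0=\frac{1-\sqrt{1-2\alpha}}{\beta\gamma}.$$ If $\alpha\le\frac12$ and $r\ge r_0$, then the Newton sequence $L_0=\tilde L$, $L_{k+1}=L_k-\nabla^2f_L(L_k)^{-1}\nabla f_L(L_k)$ is well defined (every $\nabla^2f_L(L_k)$ is invertible) and converges to a point $L^*$ that is the unique zero of $\nabla f_L$ in the closed ball of radius $r_0$ about $\tilde L$. If moreover $\alpha<\frac12$, then $L^*$ is the unique zero of $\nabla f_L$ in the closed ball about $\tilde L$ of radius $r_1=\min\{r,\frac{1+\sqrt{1-2\alpha}}{\beta\gamma}\}$, and $\|L_k-L^*\|\le(2\alpha)^{2^k}\,\eta/\alpha$ for all $k\ge0$ (read as $0$ if $\alpha=0$, in which case $\eta=0$). In all cases $L^*$ is a lngm of $f_L$. **(B)** Let $n=50$, $d=1$, and let $V$ be as above. There exist $\bar L,\tilde L\in\mathbb R^{49\times1}$ such that, with $\bar D=\mathcal K(V\bar L(V\bar L)^T)$, $r=10^{-3}$, $\bar f_L=10^3$ and $\gamma=72500$, one has $$f_L(\tilde L)>2.6\times10^3,\quad \|\nabla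 f_L(\tilde L)\|<1.8\times10^{-3},\quad \lambda_{\min}(\nabla^2f_L(\tilde L))>211,\quad \sum_{i,j}\|(V\tilde L)[i,:]-(V\tilde L)[j,:]\|\in(2127.8,2127.9);$$ all hypotheses of (A) hold for $\tilde L,r,\bar f_L,\gamma$, with $\alpha<\frac12$, $r_0<r$ and $r_1=r$. Newton's method from $\tilde L$ converges to a point $L^*\in B_r(\tilde L)$, which is the unique zero of $\nabla f_L$ in the closed ball of radius $r$ about $\tilde L$ and is a lngm of $f_L$; and $P^*=VL^*$ is a lngm of the smooth stress (of $f$). -/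

import Mathlib

open Filter Topology

noncomputable section

namespace SmoothStress

/-- `m × d` real matrices with the Frobenius (Euclidean) inner product and norm. -/
abbrev Config (m d : ℕ) : Type := EuclideanSpace ℝ (Fin m × Fin d)

/-- The matrix whose entries are the coordinates of `X`. -/
def toMat {m d : ℕ} (X : Config m d) : Matrix (Fin m) (Fin d) ℝ :=
  Matrix.of fun i j => X (i, j)

/-- The configuration whose coordinates are the entries of the matrix `A`. -/
def ofMat {m d : ℕ} (A : Matrix (Fin m) (Fin d) ℝ) : Config m d :=
  WithLp.toLp 2 fun ij => A ij.1 ij.2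

/-- The Lindenstrauss operator `K(G) = diag(G) eᵀ + e diag(G)ᵀ - 2 G`. -/
def lindenstrauss {n : ℕ} (G : Matrix (Fin n) (Fin n) ℝ) : Matrix (Fin n) (Fin n) ℝ :=
  Matrix.vecMulVec G.diag (1 : Fin n → ℝ) + Matrix.vecMulVec (1 : Fin n → ℝ) G.diag
    - (2 : ℝ) • G

/-- `K(P Pᵀ)`, the matrix of squared distances between the rows of `P`. -/
def edm {n d : ℕ} (P : Config n d) : Matrix (Fin n) (Fin n) ℝ :=
  lindenstrauss (toMat P * (toMat P).transpose)

/-- The squared Frobenius norm of a matrix. -/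
def frobSq {m n : ℕ} (A : Matrix (Fin m) (Fin n) ℝ) : ℝ :=
  ∑ i, ∑ j, A i j ^ 2

/-- The objective `f(P) = ½ ‖K(P Pᵀ) - D‖_F²`, one half of the smooth stress. -/
def f {n d : ℕ} (D : Matrix (Fin n) (Fin n) ℝ) (P : Config n d) : ℝ :=
  1 / 2 * frobSq (edm P - D)

/-- `VᵀV = I` and `Vᵀe = 0`: the columns of `V` are an orthonormal basis of `e^⊥`. -/
def IsCentering {n : ℕ} (V : Matrix (Fin n) (Fin (n - 1)) ℝ) : Prop :=
  V.transpose * V = 1 ∧ V.transpose.mulVec 1 = 0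

/-- `Pᵀe = 0`. -/
def IsCentered {n d : ℕ} (P : Config n d) : Prop :=
  (toMat P).transpose.mulVec 1 = 0

/-- `V L`. -/
def lift {n d : ℕ} (V : Matrix (Fin n) (Fin (n - 1)) ℝ) (L : Config (n - 1) d) : Config n d :=
  ofMat (V * toMat L)

/-- The reduced objective `f_L(L) = ½ ‖K(V L (V L)ᵀ) - D‖_F²`. -/
def fL {n d : ℕ} (V : Matrix (Fin n) (Fin (n - 1)) ℝ) (D : Matrix (Fin n) (Fin n) ℝ)
    (L : Config (n - 1) d) : ℝ :=
  f D (lift V L)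

/-- `∑ᵢⱼ ‖P[i,:] - P[j,:]‖` (Euclidean norm of rows). -/
def sumDist {n d : ℕ} (P : Config n d) : ℝ :=
  ∑ i, ∑ j, Real.sqrt (∑ k, (toMat P i k - toMat P j k) ^ 2)

section Generic

variable {E : Type*} [NormedAddCommGroup E] [InnerProductSpace ℝ E] [CompleteSpace E]

/-- A local nonglobal minimizer. -/
def IsLngm (g : E → ℝ) (x : E) : Prop :=
  IsLocalMin g x ∧ ¬ ∀ y, g x ≤ g y

/-- The Hessian `∇²g(x)`, as the derivative of the gradient. -/
def hess (g : E → ℝ) (x : E) : E →L[ℝ] E :=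
  fderiv ℝ (gradient g) x

/-- `T ≻ 0`. -/
def PosDef (T : E →L[ℝ] E) : Prop :=
  (T : E →ₗ[ℝ] E).IsSymmetric ∧ ∀ x, x ≠ 0 → 0 < inner ℝ (T x) x

/-- The Newton sequence for `∇g = 0` started at `x`. -/
def newton (g : E → ℝ) (x : E) : ℕ → E
  | 0 => x
  | k + 1 => newton g x k - (hess g (newton g x k)).inverse (gradient g (newton g x k))

/-- `β = ‖∇²g(x)⁻¹‖` (operator norm). -/
def beta (g : E → ℝ) (x : E) : ℝ := ‖(hess g x).inverse‖

/-- `η = ‖∇²g(x)⁻¹ ∇g(x)‖`. -/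
def eta (g : E → ℝ) (x : E) : ℝ := ‖(hess g x).inverse (gradient g x)‖

/-- `α = β γ η`. -/
def alpha (g : E → ℝ) (x : E) (γ : ℝ) : ℝ := beta g x * γ * eta g x

/-- `r₀ = (1 - √(1 - 2α)) / (β γ)`. -/
def rZero (g : E → ℝ) (x : E) (γ : ℝ) : ℝ :=
  (1 - Real.sqrt (1 - 2 * alpha g x γ)) / (beta g x * γ)

/-- `r₁ = min {r, (1 + √(1 - 2α)) / (β γ)}`. -/
def rOne (g : E → ℝ) (x : E) (r γ : ℝ) : ℝ :=
  min r ((1 + Real.sqrt (1 - 2 * alpha g x γ)) / (beta g x * γ))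

/-- On the open ball `B_r(x)` the Hessian of `g` is positive definite and has Lipschitz constant
`γ` (in operator norm), and `g` is bounded below by `c > 0`. -/
structure IsAdmissible (g : E → ℝ) (x : E) (r c γ : ℝ) : Prop where
  r_pos : 0 < r
  c_pos : 0 < c
  gamma_pos : 0 < γ
  posDef : ∀ y ∈ Metric.ball x r, PosDef (hess g y)
  lower : ∀ y ∈ Metric.ball x r, c < g y
  lipschitz : ∀ y ∈ Metric.ball x r, ∀ z ∈ Metric.ball x r,
    ‖hess g y - hess g z‖ ≤ γ * ‖y - z‖

end Generic

end SmoothStress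

end

noncomputable section

namespace SmoothStress

/-! ### Newton–Kantorovich theorem for a gradient, by a majorizing quadratic -/

section NewtonKantorovich

variable {E : Type*} [NormedAddCommGroup E] [InnerProductSpace ℝ E]

/-! Part (A) is Newton–Kantorovich with sharp radii, plus an argument that the limit is a strict
minimum even in the borderline case. Newton's iterates are compared with Newton's method for a
scalar quadratic with roots `rZero` and `rTwo`. The distances `s`, `w` from the scalar iterates to
the two roots evolve by `s ↦ s²/(s+w)`, `w ↦ w²/(s+w)`, and `newton_majorized` shows that each
vector step is at most the scalar one. Convergence and the quadratic rate then follow from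
elementary facts about `(s, w)`. Uniqueness is independent of this: positive definiteness on the
open ball already forbids a second zero of the gradient in the closed ball of radius `r` (Rolle
along a segment, `eq_of_gradient_eq_zero`).

The reduced stress is a quartic `½ ∑ (‖Tᵢ x‖² - dᵢ)²` with `Tᵢ` linear. If `α = 1/2` and `r₀ = r`,
the limit may lie on the sphere of radius `r`, where the Lipschitz estimate yields only a
semidefinite Hessian. However, the Hessian form is a quadratic polynomial along segments, with
positive leading coefficient because any two nonzero directions are moved by a common row difference
(`Entangled`). This restores definiteness (`IsAdmissible.posDef_of_mem_closedBall`). The minimum is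
not global because the true configuration has value `0` while the limit has value at least `c > 0`.

For part (B), fifty points sit in three clusters on a line, of sizes 35, 14 and 1, and the single
point lies on the wrong side of the large cluster. In dimension one the Hessian is a weighted graph
Laplacian, so coercivity, the Lipschitz constant and the gradient bound reduce to rational
arithmetic on three positions, independent of `V`. Part (A) then applies, and translation invariance
carries the minimizer from `fL` to `f`. -/

theorem isInvertible_of_coercive [FiniteDimensional ℝ E] {T : E →L[ℝ] E} {b : ℝ} (hb : 0 < b)
    (hT : ∀ v, b * ‖v‖ ^ 2 ≤ inner ℝ (T v) v) : T.IsInvertible := by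
  have hinj : Function.Injective (T : E →ₗ[ℝ] E) := by
    rw [← LinearMap.ker_eq_bot, LinearMap.ker_eq_bot']
    intro v hv
    have h := hT v
    have hv' : T v = 0 := hv
    rw [hv', inner_zero_left] at h
    have : ‖v‖ ^ 2 = 0 := by nlinarith [sq_nonneg ‖v‖]
    simpa using this
  refine ⟨(LinearEquiv.ofInjectiveEndo (T : E →ₗ[ℝ] E) hinj).toContinuousLinearEquiv, ?_⟩
  ext v
  rfl

theorem norm_inverse_apply_le_of_coercive [FiniteDimensional ℝ E] {T : E →L[ℝ] E} {b : ℝ}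
    (hb : 0 < b) (hT : ∀ v, b * ‖v‖ ^ 2 ≤ inner ℝ (T v) v) (y : E) :
    ‖T.inverse y‖ ≤ ‖y‖ / b := by
  have h := hT (T.inverse y)
  rw [(isInvertible_of_coercive hb hT).self_apply_inverse] at h
  have h2 := real_inner_le_norm y (T.inverse y)
  rw [le_div_iff₀ hb]
  rcases (norm_nonneg (T.inverse y)).eq_or_lt with h0 | h0
  · rw [← h0]; simp
  · nlinarith

theorem PosDef.isInvertible [CompleteSpace E] [FiniteDimensional ℝ E] {T : E →L[ℝ] E}
    (hT : PosDef T) : T.IsInvertible := by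
  have hinj : Function.Injective (T : E →ₗ[ℝ] E) := by
    rw [← LinearMap.ker_eq_bot, LinearMap.ker_eq_bot']
    intro v hv
    by_contra hne
    have h := hT.2 v hne
    have hv' : T v = 0 := hv
    rw [hv', inner_zero_left] at h
    exact h.false
  refine ⟨(LinearEquiv.ofInjectiveEndo (T : E →ₗ[ℝ] E) hinj).toContinuousLinearEquiv, ?_⟩
  ext v
  rfl

theorem PosDef.inner_nonneg [CompleteSpace E] {T : E →L[ℝ] E} (hT : PosDef T) (v : E) :
    0 ≤ inner ℝ (T v) v := by
  rcases eq_or_ne v 0 with rfl | hv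
  · simp
  · exact (hT.2 v hv).le

theorem PosDef.norm_inverse_pos [CompleteSpace E] [FiniteDimensional ℝ E] [Nontrivial E]
    {T : E →L[ℝ] E} (hT : PosDef T) : 0 < ‖T.inverse‖ := by
  rw [norm_pos_iff]
  intro h
  obtain ⟨v, hv⟩ := exists_ne (0 : E)
  have := hT.isInvertible.self_apply_inverse v
  rw [h] at this
  simp at this
  exact hv this.symm

/-- No spectral theorem is needed: with `β = ‖T⁻¹‖`, expand the nonnegative form of `T` at `v - β⁻¹
T⁻¹ v` and use `⟪v, T⁻¹ v⟫ ≤ β ‖v‖²`. -/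
theorem PosDef.coercive [CompleteSpace E] [FiniteDimensional ℝ E] [Nontrivial E]
    {T : E →L[ℝ] E} (hT : PosDef T) (v : E) :
    1 / ‖T.inverse‖ * ‖v‖ ^ 2 ≤ inner ℝ (T v) v := by
  have hβ := hT.norm_inverse_pos
  set β := ‖T.inverse‖ with hβdef
  set w := T.inverse v with hw
  have hTw : T w = v := hT.isInvertible.self_apply_inverse v
  have h0 := hT.inner_nonneg (v - (1 / β) • w)
  have hsym : inner ℝ (T v) w = inner ℝ v v := by
    have := hT.1 v w
    simp only [ContinuousLinearMap.coe_coe] at this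
    rw [this, hTw]
  have hvw : inner ℝ v w ≤ β * ‖v‖ ^ 2 := by
    refine (real_inner_le_norm v w).trans ?_
    have := T.inverse.le_opNorm v
    rw [← hβdef, ← hw] at this
    nlinarith [norm_nonneg v]
  simp only [map_sub, map_smul, hTw, inner_sub_left, inner_sub_right, real_inner_smul_left,
    real_inner_smul_right, hsym, real_inner_self_eq_norm_sq] at h0
  have h1 : 1 / β * (1 / β * inner ℝ v w) ≤ 1 / β * (1 / β * (β * ‖v‖ ^ 2)) := by
    gcongr
  have h2 : 1 / β * (1 / β * (β * ‖v‖ ^ 2)) = 1 / β * ‖v‖ ^ 2 := by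
    field_simp
  linarith

/-- Along the segment the derivative of the remainder is at most `γ ‖y - x‖² t`; integrating over
`[0, 1]` gives the factor `1/2`. Only the Lipschitz bound relative to the base point `x` is used. -/
theorem norm_sub_sub_le_of_lipschitz_fderiv {G : E → E} {H : E → E →L[ℝ] E} {s : Set E}
    (hs : Convex ℝ s) {γ : ℝ} (hG : ∀ y ∈ s, HasFDerivAt G (H y) y) {x y : E} (hx : x ∈ s)
    (hy : y ∈ s) (hL : ∀ z ∈ s, ‖H z - H x‖ ≤ γ * ‖z - x‖) :
    ‖G y - G x - H x (y - x)‖ ≤ γ / 2 * ‖y - x‖ ^ 2 := by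
  set v := y - x with hv
  have hmem : ∀ t ∈ Set.Icc (0 : ℝ) 1, x + t • v ∈ s := by
    intro t ht
    exact hs.add_smul_sub_mem hx hy ht
  have hder : ∀ t ∈ Set.Icc (0 : ℝ) 1,
      HasDerivAt (fun t : ℝ => G (x + t • v) - G x - t • H x v) (H (x + t • v) v - H x v) t := by
    intro t ht
    have h1 : HasDerivAt (fun t : ℝ => x + t • v) v t := by
      simpa using ((hasDerivAt_id t).smul_const v).const_add x
    have h2 := (hG _ (hmem t ht)).comp_hasDerivAt t h1
    have h3 : HasDerivAt (fun t : ℝ => t • H x v) (H x v) t := by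
      simpa using (hasDerivAt_id t).smul_const (H x v)
    exact (h2.sub_const (G x)).sub h3
  have key := image_norm_le_of_norm_deriv_right_le_deriv_boundary
    (f := fun t : ℝ => G (x + t • v) - G x - t • H x v)
    (f' := fun t => H (x + t • v) v - H x v) (a := 0) (b := 1)
    (B := fun t => γ / 2 * ‖v‖ ^ 2 * t ^ 2) (B' := fun t => γ * ‖v‖ ^ 2 * t)
    (fun t ht => (hder t ht).continuousAt.continuousWithinAt)
    (fun t ht => (hder t (Set.Ico_subset_Icc_self ht)).hasDerivWithinAt)
    (by simp)
    (fun t => by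
      refine ((hasDerivAt_pow 2 t).const_mul (γ / 2 * ‖v‖ ^ 2)).congr_deriv ?_
      push_cast
      ring)
    (fun t ht => by
      have h1 := hL _ (hmem t (Set.Ico_subset_Icc_self ht))
      rw [add_sub_cancel_left, norm_smul, Real.norm_of_nonneg ht.1] at h1
      calc ‖H (x + t • v) v - H x v‖ = ‖(H (x + t • v) - H x) v‖ := by simp
        _ ≤ ‖H (x + t • v) - H x‖ * ‖v‖ := ContinuousLinearMap.le_opNorm _ _
        _ ≤ (γ * (t * ‖v‖)) * ‖v‖ := by gcongr
        _ = γ * ‖v‖ ^ 2 * t := by ring)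
    (Set.right_mem_Icc.2 zero_le_one)
  simpa [hv] using key

/-- Pairs `(s, w)` of distances from Newton's iterates to the two roots of the majorizing
quadratic. -/
def majorant (s w : ℝ) : ℕ → ℝ × ℝ
  | 0 => (s, w)
  | k + 1 => ((majorant s w k).1 ^ 2 / ((majorant s w k).1 + (majorant s w k).2),
      (majorant s w k).2 ^ 2 / ((majorant s w k).1 + (majorant s w k).2))

/-- The gap `w - s` is the distance between the two fixed roots, hence invariant, since `(w² -
s²)/(s + w) = w - s`. -/
theorem majorant_spec {s w : ℝ} (hs : 0 ≤ s) (hsw : s ≤ w) (hw : 0 < w) (k : ℕ) :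
    0 ≤ (majorant s w k).1 ∧ (majorant s w k).1 ≤ (majorant s w k).2 ∧ 0 < (majorant s w k).2 ∧
      (majorant s w k).2 - (majorant s w k).1 = w - s := by
  induction k with
  | zero => exact ⟨hs, hsw, hw, rfl⟩
  | succ k ih =>
    simp only [majorant]
    generalize (majorant s w k).1 = a at *
    generalize (majorant s w k).2 = b at *
    obtain ⟨h1, h2, h3, h4⟩ := ih
    have hab : 0 < a + b := by linarith
    refine ⟨by positivity, by gcongr, by positivity, ?_⟩
    rw [← h4]
    field_simp
    ring

theorem majorant_le_geometric {s w : ℝ} (hs : 0 ≤ s) (hsw : s ≤ w) (hw : 0 < w) (k : ℕ) :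
    (majorant s w k).1 ≤ s * (1 / 2) ^ k := by
  induction k with
  | zero => simp [majorant]
  | succ k ih =>
    obtain ⟨h1, h2, h3, -⟩ := majorant_spec hs hsw hw k
    rw [pow_succ, ← mul_assoc]
    simp only [majorant]
    generalize (majorant s w k).1 = a at *
    generalize (majorant s w k).2 = b at *
    rw [div_le_iff₀ (by linarith)]
    nlinarith

theorem majorant_pos {s w : ℝ} (hs : 0 ≤ s) (hsw : s ≤ w) (hw : 0 < w) (k : ℕ)
    (h : 0 < s) : 0 < (majorant s w k).1 := by
  induction k with
  | zero => exact h
  | succ k ih =>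
    obtain ⟨h1, h2, h3, -⟩ := majorant_spec hs hsw hw k
    simp only [majorant]
    positivity

/-- The normalized product `h = 4sw/(s+w)²` satisfies `h_{k+1} ≤ h_k²`, which amounts to `(a+b)² ≤
2(a²+b²)`. At the roots `rZero`, `rTwo` its initial value is `2α`, the base of the stated rate. -/
theorem majorant_quadratic {s w : ℝ} (hs : 0 ≤ s) (hsw : s ≤ w) (hw : 0 < w) (k : ℕ) :
    4 * (majorant s w k).1 * (majorant s w k).2 /
      ((majorant s w k).1 + (majorant s w k).2) ^ 2 ≤ (4 * s * w / (s + w) ^ 2) ^ 2 ^ k := by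
  induction k with
  | zero => simp [majorant]
  | succ k ih =>
    obtain ⟨h1, h2, h3, -⟩ := majorant_spec hs hsw hw k
    rw [pow_succ 2 k, pow_mul]
    simp only [majorant]
    generalize (majorant s w k).1 = a at *
    generalize (majorant s w k).2 = b at *
    have hab : 0 < a + b := by linarith
    refine le_trans ?_ (pow_le_pow_left₀ (by positivity) ih 2)
    have e : 4 * (a ^ 2 / (a + b)) * (b ^ 2 / (a + b)) / (a ^ 2 / (a + b) + b ^ 2 / (a + b)) ^ 2
        = 4 * a ^ 2 * b ^ 2 / (a ^ 2 + b ^ 2) ^ 2 := by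
      have : 0 < a ^ 2 + b ^ 2 := by positivity
      field_simp
    rw [e, div_pow, div_le_div_iff₀ (by positivity) (by positivity)]
    have h5 : (a + b) ^ 2 ≤ 2 * (a ^ 2 + b ^ 2) := by nlinarith [sq_nonneg (a - b)]
    have h6 : ((a + b) ^ 2) ^ 2 ≤ (2 * (a ^ 2 + b ^ 2)) ^ 2 :=
      pow_le_pow_left₀ (by positivity) h5 2
    calc 4 * a ^ 2 * b ^ 2 * ((a + b) ^ 2) ^ 2
        ≤ 4 * a ^ 2 * b ^ 2 * (2 * (a ^ 2 + b ^ 2)) ^ 2 := by gcongr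
      _ = (4 * a * b) ^ 2 * (a ^ 2 + b ^ 2) ^ 2 := by ring

theorem majorant_fst_le {s w : ℝ} (hs : 0 ≤ s) (hsw : s ≤ w) (hw : 0 < w) (k : ℕ) :
    (majorant s w k).1 ≤ (4 * s * w / (s + w) ^ 2) ^ 2 ^ k * ((s + w) / 2) := by
  obtain ⟨h1, h2, h3, h4⟩ := majorant_spec hs hsw hw k
  have hle : (majorant s w k).1 ≤ s := by
    refine (majorant_le_geometric hs hsw hw k).trans ?_
    exact mul_le_of_le_one_right hs (pow_le_one₀ (by norm_num) (by norm_num))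
  have h5 := majorant_quadratic hs hsw hw k
  generalize (majorant s w k).1 = a at *
  generalize (majorant s w k).2 = b at *
  have hab : 0 < a + b := by linarith
  calc a ≤ 4 * a * b / (a + b) ^ 2 * ((a + b) / 2) := by
        rw [show 4 * a * b / (a + b) ^ 2 * ((a + b) / 2) = 2 * a * b / (a + b) by
          field_simp; ring, le_div_iff₀ hab]
        nlinarith
    _ ≤ (4 * s * w / (s + w) ^ 2) ^ 2 ^ k * ((s + w) / 2) := by
        gcongr
        linarith

variable [CompleteSpace E]

/-- Rolle's theorem for `t ↦ ⟪∇g(y + t v), v⟫`. The closed ball is strictly convex, so the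
intermediate point lies in the open ball even if both zeros lie on the sphere. -/
theorem eq_of_gradient_eq_zero {g : E → ℝ} {x : E} {r : ℝ} (hr : 0 < r)
    (hd : Differentiable ℝ (gradient g)) (hpos : ∀ y ∈ Metric.ball x r, PosDef (hess g y))
    {y z : E} (hy : y ∈ Metric.closedBall x r) (hz : z ∈ Metric.closedBall x r)
    (gy : gradient g y = 0) (gz : gradient g z = 0) : y = z := by
  by_contra hne
  set v := z - y with hv
  have hv0 : v ≠ 0 := sub_ne_zero.2 (Ne.symm hne)
  have hder : ∀ t : ℝ, HasDerivAt (fun t : ℝ => inner ℝ (gradient g (y + t • v)) v)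
      (inner ℝ (hess g (y + t • v) v) v) t := by
    intro t
    have h1 : HasDerivAt (fun t : ℝ => y + t • v) v t := by
      simpa using ((hasDerivAt_id t).smul_const v).const_add y
    have h2 := (hd (y + t • v)).hasFDerivAt.comp_hasDerivAt t h1
    simpa [hess] using h2.inner ℝ (hasDerivAt_const t v)
  obtain ⟨t, ht, h0⟩ := exists_hasDerivAt_eq_zero
    (f := fun t : ℝ => inner ℝ (gradient g (y + t • v)) v) zero_lt_one
    (fun t _ => (hder t).continuousAt.continuousWithinAt)
    (by simp [hv, gy, gz]) (fun t _ => hder t)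
  have hmem : y + t • v ∈ Metric.ball x r := by
    rw [← interior_closedBall x hr.ne']
    exact (strictConvex_closedBall ℝ x r).openSegment_subset hy hz hne
      (by rw [openSegment_eq_image']; exact ⟨t, ht, rfl⟩)
  exact ((hpos _ hmem).2 v hv0).ne' h0

variable [FiniteDimensional ℝ E]

theorem IsAdmissible.coercive [Nontrivial E] {g : E → ℝ} {x : E} {r c γ : ℝ}
    (h : IsAdmissible g x r c γ) {y : E} (hy : y ∈ Metric.ball x r) (v : E) :
    (1 / beta g x - γ * ‖y - x‖) * ‖v‖ ^ 2 ≤ inner ℝ (hess g y v) v := by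
  have hx := Metric.mem_ball_self (x := x) h.r_pos
  have h1 := (h.posDef x hx).coercive v
  have h2 := h.lipschitz y hy x hx
  have h3 : inner ℝ ((hess g x - hess g y) v) v ≤ γ * ‖y - x‖ * ‖v‖ ^ 2 := by
    refine (real_inner_le_norm _ _).trans ?_
    have := (hess g x - hess g y).le_opNorm v
    rw [norm_sub_rev] at h2
    calc ‖(hess g x - hess g y) v‖ * ‖v‖ ≤ (‖hess g x - hess g y‖ * ‖v‖) * ‖v‖ := by gcongr
      _ ≤ (γ * ‖y - x‖ * ‖v‖) * ‖v‖ := by gcongr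
      _ = γ * ‖y - x‖ * ‖v‖ ^ 2 := by ring
  rw [sub_apply, inner_sub_left] at h3
  change 1 / beta g x * ‖v‖ ^ 2 ≤ _ at h1
  linarith

theorem IsAdmissible.beta_pos [Nontrivial E] {g : E → ℝ} {x : E} {r c γ : ℝ}
    (h : IsAdmissible g x r c γ) : 0 < beta g x :=
  (h.posDef x (Metric.mem_ball_self h.r_pos)).norm_inverse_pos

/-- The other root of the majorizing quadratic. -/
def rTwo (g : E → ℝ) (x : E) (γ : ℝ) : ℝ :=
  (1 + Real.sqrt (1 - 2 * alpha g x γ)) / (beta g x * γ)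

theorem majorant_roots [Nontrivial E] {g : E → ℝ} {x : E} {r c γ : ℝ}
    (h : IsAdmissible g x r c γ) (hα : alpha g x γ ≤ 1 / 2) :
    0 ≤ rZero g x γ ∧ rZero g x γ ≤ rTwo g x γ ∧ 0 < rTwo g x γ ∧
      rZero g x γ + rTwo g x γ = 2 / (beta g x * γ) ∧
      rZero g x γ * rTwo g x γ = 2 * eta g x / (beta g x * γ) := by
  have hβ := h.beta_pos
  have hγ := h.gamma_pos
  have hα0 : 0 ≤ alpha g x γ := by
    unfold alpha eta; positivity
  have hs := Real.sqrt_nonneg (1 - 2 * alpha g x γ)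
  have hs1 : Real.sqrt (1 - 2 * alpha g x γ) ≤ 1 := by
    rw [Real.sqrt_le_one]; linarith
  have hs2 := Real.sq_sqrt (show 0 ≤ 1 - 2 * alpha g x γ by linarith)
  have ha : alpha g x γ = beta g x * γ * eta g x := rfl
  unfold rZero rTwo
  set S := Real.sqrt (1 - 2 * alpha g x γ)
  refine ⟨div_nonneg (by linarith) (by positivity), by gcongr; linarith, by positivity, ?_, ?_⟩
  · field_simp; ring
  · rw [ha] at hs2
    field_simp
    linarith

/-- The position bound telescopes from the step bounds. The next step is controlled by a Taylor
bound on the new gradient and by coercivity of the Hessian, perturbed from its value at `x`. -/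
theorem newton_majorized [Nontrivial E] {g : E → ℝ} {x : E} {r c γ : ℝ}
    (hd : Differentiable ℝ (gradient g)) (h : IsAdmissible g x r c γ)
    (hα : alpha g x γ ≤ 1 / 2) (hr : rZero g x γ ≤ r) (k : ℕ) :
    newton g x k ∈ Metric.ball x r ∧
    ‖newton g x k - x‖ ≤ rZero g x γ - (majorant (rZero g x γ) (rTwo g x γ) k).1 ∧
    ‖newton g x (k + 1) - newton g x k‖ ≤
      (majorant (rZero g x γ) (rTwo g x γ) k).1 -
        (majorant (rZero g x γ) (rTwo g x γ) (k + 1)).1 := by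
  obtain ⟨hs, hsw, hw, hsum, hprod⟩ := majorant_roots h hα
  have hβ := h.beta_pos
  have hγ := h.gamma_pos
  have hball : ∀ k, ‖newton g x k - x‖ ≤
      rZero g x γ - (majorant (rZero g x γ) (rTwo g x γ) k).1 →
      newton g x k ∈ Metric.ball x r := by
    intro k hk
    rw [mem_ball_iff_norm]
    -- Iterates stay in the open ball even if `r₀ = r`: the remaining distance `s_k` is strictly
    -- positive unless `r₀ = 0 < r`.
    rcases hs.eq_or_lt with h0 | h0
    · have := (majorant_spec hs hsw hw k).1
      have := h.r_pos
      linarith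
    · have := majorant_pos hs hsw hw k h0
      linarith
  suffices hmain : ‖newton g x k - x‖ ≤
      rZero g x γ - (majorant (rZero g x γ) (rTwo g x γ) k).1 ∧
    ‖newton g x (k + 1) - newton g x k‖ ≤ (majorant (rZero g x γ) (rTwo g x γ) k).1 -
        (majorant (rZero g x γ) (rTwo g x γ) (k + 1)).1 from
    ⟨hball k hmain.1, hmain.1, hmain.2⟩
  induction k with
  | zero =>
    refine ⟨by simp [newton, majorant], ?_⟩
    simp only [newton, majorant]
    rw [sub_sub_cancel_left, norm_neg]
    have e : rZero g x γ - rZero g x γ ^ 2 / (rZero g x γ + rTwo g x γ) =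
        rZero g x γ * rTwo g x γ / (rZero g x γ + rTwo g x γ) := by
      have : 0 < rZero g x γ + rTwo g x γ := by linarith
      field_simp; ring
    rw [e, hprod, hsum]
    have : 2 * eta g x / (beta g x * γ) / (2 / (beta g x * γ)) = eta g x := by
      field_simp
    rw [this]
    rfl
  | succ k ih =>
    obtain ⟨ih1, ih2⟩ := ih
    have hk1 : ‖newton g x (k + 1) - x‖ ≤
        rZero g x γ - (majorant (rZero g x γ) (rTwo g x γ) (k + 1)).1 := by
      have := norm_add_le (newton g x (k + 1) - newton g x k) (newton g x k - x)
      rw [sub_add_sub_cancel] at this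
      linarith
    refine ⟨hk1, ?_⟩
    have hm := hball k ih1
    have hm1 := hball (k + 1) hk1
    have hinv := (h.posDef _ hm).isInvertible
    have htay := norm_sub_sub_le_of_lipschitz_fderiv (convex_ball x r)
      (G := gradient g) (H := hess g) (γ := γ) (fun y _ => (hd y).hasFDerivAt) hm hm1
      (fun z hz => h.lipschitz z hz _ hm)
    have hstep : hess g (newton g x k) (newton g x (k + 1) - newton g x k) =
        - gradient g (newton g x k) := by
      simp only [newton]
      rw [sub_sub_cancel_left, map_neg, hinv.self_apply_inverse]
    rw [hstep, sub_neg_eq_add, sub_add_cancel] at htay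
    obtain ⟨p1, p2, p3, p4⟩ := majorant_spec hs hsw hw k
    obtain ⟨q1, q2, q3, q4⟩ := majorant_spec hs hsw hw (k + 1)
    -- `b` is the absolute slope of the majorizing quadratic at its iterate `k + 1`. Initially this
    -- slope is `γ/2 · (r₀ + rTwo) = 1/β`.
    set b := γ / 2 * ((majorant (rZero g x γ) (rTwo g x γ) (k + 1)).1 +
      (majorant (rZero g x γ) (rTwo g x γ) (k + 1)).2) with hb
    have hb0 : 0 < b := by
      have : 0 < (majorant (rZero g x γ) (rTwo g x γ) (k + 1)).1 +
        (majorant (rZero g x γ) (rTwo g x γ) (k + 1)).2 := by linarith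
      positivity
    have hbb : b ≤ 1 / beta g x - γ * ‖newton g x (k + 1) - x‖ := by
      have e1 : 1 / beta g x = γ / 2 * (rZero g x γ + rTwo g x γ) := by
        rw [hsum]; field_simp
      have e2 : γ * ‖newton g x (k + 1) - x‖ ≤
        γ * (rZero g x γ - (majorant (rZero g x γ) (rTwo g x γ) (k + 1)).1) := by gcongr
      rw [e1, hb]
      nlinarith
    have hco : ∀ v, b * ‖v‖ ^ 2 ≤ inner ℝ (hess g (newton g x (k + 1)) v) v := fun v =>
      le_trans (by gcongr) (h.coercive hm1 v)
    have hfin := norm_inverse_apply_le_of_coercive hb0 hco (gradient g (newton g x (k + 1)))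
    have e3 : newton g x (k + 1 + 1) - newton g x (k + 1) =
        -(hess g (newton g x (k + 1))).inverse (gradient g (newton g x (k + 1))) := by
      rw [show newton g x (k + 1 + 1) = newton g x (k + 1) -
        (hess g (newton g x (k + 1))).inverse (gradient g (newton g x (k + 1))) from rfl]
      abel
    rw [e3, norm_neg]
    refine hfin.trans ?_
    rw [div_le_iff₀ hb0]
    refine htay.trans ?_
    have h4 : ‖newton g x (k + 1) - newton g x k‖ ^ 2 ≤
      ((majorant (rZero g x γ) (rTwo g x γ) k).1 -
        (majorant (rZero g x γ) (rTwo g x γ) (k + 1)).1) ^ 2 :=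
      pow_le_pow_left₀ (norm_nonneg _) ih2 2
    -- Here the majorant is exact: both sides equal `γ/2 · s_{k+1} w_{k+1}`, because `s_k - s_{k+1}
    -- = s_k w_k / (s_k + w_k)`.
    refine (mul_le_mul_of_nonneg_left h4 (by positivity : 0 ≤ γ / 2)).trans (le_of_eq ?_)
    rw [hb]
    simp only [majorant]
    generalize (majorant (rZero g x γ) (rTwo g x γ) k).1 = s at *
    generalize (majorant (rZero g x γ) (rTwo g x γ) k).2 = w at *
    have hsw0 : 0 < s + w := by linarith
    have hsw2 : 0 < s ^ 2 + w ^ 2 := by positivity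
    field_simp
    ring

/-- The Newton–Kantorovich theorem for the gradient of `g`. -/
theorem newton_kantorovich [Nontrivial E] {g : E → ℝ} {x : E} {r c γ : ℝ}
    (hd : Differentiable ℝ (gradient g)) (h : IsAdmissible g x r c γ)
    (hα : alpha g x γ ≤ 1 / 2) (hr : rZero g x γ ≤ r) :
    (∀ k, (hess g (newton g x k)).IsInvertible) ∧
    ∃ y, Tendsto (newton g x) atTop (𝓝 y) ∧ y ∈ Metric.closedBall x (rZero g x γ) ∧
      gradient g y = 0 ∧
      ∀ k, ‖newton g x k - y‖ ≤ (2 * alpha g x γ) ^ 2 ^ k * (eta g x / alpha g x γ) := by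
  obtain ⟨hs, hsw, hw, hsum, hprod⟩ := majorant_roots h hα
  have hβ := h.beta_pos
  have hγ := h.gamma_pos
  have hm := newton_majorized hd h hα hr
  refine ⟨fun k => (h.posDef _ (hm k).1).isInvertible, ?_⟩
  have hdist : ∀ k, dist (newton g x k) (newton g x (k + 1)) ≤ rZero g x γ * (1 / 2) ^ k := by
    intro k
    rw [dist_comm, dist_eq_norm]
    have := majorant_le_geometric hs hsw hw k
    have := (majorant_spec hs hsw hw (k + 1)).1
    linarith [(hm k).2.2]
  obtain ⟨y, hy⟩ := cauchySeq_tendsto_of_complete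
    (cauchySeq_of_le_geometric (1 / 2) (rZero g x γ) (by norm_num) hdist)
  have hle : ∀ k m, ‖newton g x (k + m) - newton g x k‖ ≤
      (majorant (rZero g x γ) (rTwo g x γ) k).1 -
        (majorant (rZero g x γ) (rTwo g x γ) (k + m)).1 := by
    intro k m
    induction m with
    | zero => simp
    | succ m ih =>
      have h1 := norm_add_le (newton g x (k + m + 1) - newton g x (k + m))
        (newton g x (k + m) - newton g x k)
      rw [sub_add_sub_cancel] at h1
      have h2 := (hm (k + m)).2.2
      rw [← add_assoc]
      linarith
  have hlim : ∀ k, ‖newton g x k - y‖ ≤ (majorant (rZero g x γ) (rTwo g x γ) k).1 := by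
    intro k
    have ht : Tendsto (fun m => ‖newton g x (k + m) - newton g x k‖) atTop
        (𝓝 ‖y - newton g x k‖) := by
      have := (tendsto_add_atTop_iff_nat k).2 hy
      simp_rw [add_comm _ k] at this
      exact (this.sub_const _).norm
    rw [norm_sub_rev]
    refine le_of_tendsto' ht fun m => (hle k m).trans ?_
    have := (majorant_spec hs hsw hw (k + m)).1
    linarith
  have hzero : gradient g y = 0 := by
    -- The Hessians along the sequence are bounded and the steps tend to `0`. By the Newton
    -- equation, so do the gradients.
    have ht : Tendsto (fun k => hess g (newton g x k) (newton g x (k + 1) - newton g x k))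
        atTop (𝓝 0) := by
      have hnorm : Tendsto (fun k => (‖hess g x‖ + γ * r) * (rZero g x γ * (1 / 2) ^ k)) atTop
          (𝓝 0) := by
        have := (tendsto_pow_atTop_nhds_zero_of_lt_one (r := (1 / 2 : ℝ)) (by norm_num)
          (by norm_num)).const_mul (rZero g x γ) |>.const_mul (‖hess g x‖ + γ * r)
        simpa using this
      refine squeeze_zero_norm (fun k => ?_) hnorm
      refine (ContinuousLinearMap.le_opNorm _ _).trans ?_
      have h1 := hdist k
      rw [dist_comm, dist_eq_norm] at h1
      have h2 := h.lipschitz _ (hm k).1 x (Metric.mem_ball_self h.r_pos)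
      have h3 : ‖newton g x k - x‖ ≤ r := (mem_ball_iff_norm.1 (hm k).1).le
      have h4 : ‖hess g (newton g x k)‖ ≤ ‖hess g x‖ + γ * r := by
        have := norm_add_le (hess g (newton g x k) - hess g x) (hess g x)
        rw [sub_add_cancel] at this
        have : γ * ‖newton g x k - x‖ ≤ γ * r := by gcongr
        linarith
      have := h.r_pos
      gcongr
    have ht2 : Tendsto (fun k => gradient g (newton g x k)) atTop (𝓝 (gradient g y)) :=
      (hd.continuous.tendsto y).comp hy
    have heq : ∀ k, hess g (newton g x k) (newton g x (k + 1) - newton g x k) =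
        - gradient g (newton g x k) := by
      intro k
      simp only [newton]
      rw [sub_sub_cancel_left, map_neg, (h.posDef _ (hm k).1).isInvertible.self_apply_inverse]
    simp_rw [heq] at ht
    have := tendsto_nhds_unique ht ht2.neg
    exact neg_eq_zero.1 this.symm
  refine ⟨y, hy, ?_, hzero, fun k => ?_⟩
  · have := hlim 0
    rw [mem_closedBall_iff_norm, norm_sub_rev]
    exact this
  · refine (hlim k).trans ?_
    refine (majorant_fst_le hs hsw hw k).trans (le_of_eq ?_)
    have ha : alpha g x γ = beta g x * γ * eta g x := rfl
    have e1 : 4 * rZero g x γ * rTwo g x γ / (rZero g x γ + rTwo g x γ) ^ 2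
        = 2 * alpha g x γ := by
      rw [mul_assoc, hprod, hsum, ha]
      field_simp
      norm_num
    rw [e1, hsum]
    -- If `η = 0`, then `α = 0` and `η/α` is `0` by the convention for division; the left side
    -- vanishes too, as the exponent `2 ^ k` is positive.
    rcases eq_or_ne (eta g x) 0 with h0 | h0
    · rw [ha, h0]; simp
    · rw [ha]
      field_simp

end NewtonKantorovich

/-! ### Sums of squared quadratics: derivatives, local minima, the boundary case -/

section Quartic

variable {ι E F : Type*} [Fintype ι] [NormedAddCommGroup E] [InnerProductSpace ℝ E]
  [NormedAddCommGroup F] [InnerProductSpace ℝ F]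

/-- The quartic `½ ∑ᵢ (‖Tᵢ x‖² - dᵢ)²`. -/
def quartic (T : ι → E →L[ℝ] F) (d : ι → ℝ) (x : E) : ℝ :=
  1 / 2 * ∑ i, (‖T i x‖ ^ 2 - d i) ^ 2

theorem norm_map_add_sq (A : E →L[ℝ] F) (x h : E) :
    ‖A (x + h)‖ ^ 2 = ‖A x‖ ^ 2 + 2 * inner ℝ (A x) (A h) + ‖A h‖ ^ 2 := by
  rw [map_add, norm_add_sq_real]

theorem continuous_quartic (T : ι → E →L[ℝ] F) (d : ι → ℝ) : Continuous (quartic T d) := by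
  unfold quartic
  fun_prop

theorem IsAdmissible.le_of_mem_closedBall [CompleteSpace E] {T : ι → E →L[ℝ] F} {d : ι → ℝ}
    {x : E} {r c γ : ℝ}
    (h : IsAdmissible (quartic T d) x r c γ) {y : E} (hy : y ∈ Metric.closedBall x r) :
    c ≤ quartic T d y := by
  rw [← closure_ball x h.r_pos.ne'] at hy
  exact le_on_closure (f := fun _ => c) (fun z hz => (h.lower z hz).le) continuousOn_const
    (continuous_quartic T d).continuousOn hy

variable [CompleteSpace E] [CompleteSpace F]

def quarticGrad (T : ι → E →L[ℝ] F) (d : ι → ℝ) (x : E) : E :=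
  ∑ i, (2 * (‖T i x‖ ^ 2 - d i)) • (T i).adjoint (T i x)

def quarticHess (T : ι → E →L[ℝ] F) (d : ι → ℝ) (x : E) : E →L[ℝ] E :=
  ∑ i, ((2 * (‖T i x‖ ^ 2 - d i)) • ((T i).adjoint ∘L T i) +
    ((4 : ℝ) • (innerSL ℝ (T i x) ∘L T i)).smulRight ((T i).adjoint (T i x)))

variable (T : ι → E →L[ℝ] F) (d : ι → ℝ)

theorem inner_quarticGrad (x h : E) :
    inner ℝ (quarticGrad T d x) h =
      ∑ i, 2 * (‖T i x‖ ^ 2 - d i) * inner ℝ (T i x) (T i h) := by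
  simp only [quarticGrad, sum_inner, real_inner_smul_left, ContinuousLinearMap.adjoint_inner_left]

theorem inner_quarticHess (x h k : E) :
    inner ℝ (quarticHess T d x h) k =
      ∑ i, (2 * (‖T i x‖ ^ 2 - d i) * inner ℝ (T i h) (T i k) +
        4 * inner ℝ (T i x) (T i h) * inner ℝ (T i x) (T i k)) := by
  simp only [quarticHess, sum_apply, sum_inner]
  refine Finset.sum_congr rfl fun i _ => ?_
  simp [inner_add_left, real_inner_smul_left, ContinuousLinearMap.adjoint_inner_left]

theorem hasGradientAt_quartic (x : E) :
    HasGradientAt (quartic T d) (quarticGrad T d x) x := by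
  rw [hasGradientAt_iff_hasFDerivAt]
  have h := HasFDerivAt.const_mul (HasFDerivAt.fun_sum (u := Finset.univ) (x := x) fun i _ =>
    ((((T i).hasFDerivAt (x := x)).norm_sq).sub_const (d i)).pow 2) (1 / 2 : ℝ)
  refine h.congr_fderiv ?_
  ext k
  rw [InnerProductSpace.toDual_apply_apply, inner_quarticGrad]
  simp only [smul_apply, sum_apply, smul_eq_mul, Finset.mul_sum]
  refine Finset.sum_congr rfl fun i _ => ?_
  simp
  ring

theorem gradient_quartic : gradient (quartic T d) = quarticGrad T d :=
  funext fun x => (hasGradientAt_quartic T d x).gradient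

theorem hasFDerivAt_quarticGrad (x : E) :
    HasFDerivAt (quarticGrad T d) (quarticHess T d x) x := by
  refine HasFDerivAt.fun_sum fun i _ => ?_
  refine ((((((T i).hasFDerivAt (x := x)).norm_sq).sub_const (d i)).const_mul 2).smul
    (((T i).adjoint ∘L T i).hasFDerivAt (x := x))).congr_fderiv ?_
  ext k
  simp
  congr 1
  ring

theorem hess_quartic (x : E) : hess (quartic T d) x = quarticHess T d x := by
  rw [hess, gradient_quartic]
  exact (hasFDerivAt_quarticGrad T d x).fderiv

theorem differentiable_gradient_quartic : Differentiable ℝ (gradient (quartic T d)) := by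
  rw [gradient_quartic]
  exact fun x => (hasFDerivAt_quarticGrad T d x).differentiableAt

theorem isSymmetric_quarticHess (x : E) :
    (quarticHess T d x : E →ₗ[ℝ] E).IsSymmetric := by
  intro h k
  simp only [ContinuousLinearMap.coe_coe]
  rw [real_inner_comm _ h, inner_quarticHess, inner_quarticHess]
  refine Finset.sum_congr rfl fun i _ => ?_
  rw [real_inner_comm (T i k) (T i h)]
  ring

theorem quartic_add (x h : E) :
    quartic T d (x + h) = quartic T d x + inner ℝ (quarticGrad T d x) h +
      1 / 2 * inner ℝ (quarticHess T d x h) h +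
      ∑ i, (2 * inner ℝ (T i x) (T i h) * ‖T i h‖ ^ 2 + 1 / 2 * (‖T i h‖ ^ 2) ^ 2) := by
  simp only [quartic, inner_quarticGrad, inner_quarticHess, Finset.mul_sum,
    ← Finset.sum_add_distrib, norm_map_add_sq]
  refine Finset.sum_congr rfl fun i _ => ?_
  rw [real_inner_self_eq_norm_sq]
  ring

/-- In the exact expansion `quartic_add` the degree-four remainder is nonnegative, so only the cubic
term, at most `M ‖h‖³` in size, competes with the Hessian. -/
theorem isLocalMin_quartic {x : E} {μ : ℝ} (hμ : 0 < μ) (hgrad : quarticGrad T d x = 0)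
    (hco : ∀ v, μ * ‖v‖ ^ 2 ≤ inner ℝ (quarticHess T d x v) v) :
    IsLocalMin (quartic T d) x := by
  set M : ℝ := ∑ i, 2 * (‖T i x‖ * ‖T i‖) * ‖T i‖ ^ 2 with hM
  have hM0 : 0 ≤ M := Finset.sum_nonneg fun i _ => by positivity
  have hrem : ∀ h : E, -(M * ‖h‖ ^ 3) ≤
      ∑ i, (2 * inner ℝ (T i x) (T i h) * ‖T i h‖ ^ 2 + 1 / 2 * (‖T i h‖ ^ 2) ^ 2) := by
    intro h
    rw [hM, Finset.sum_mul, ← Finset.sum_neg_distrib]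
    refine Finset.sum_le_sum fun i _ => ?_
    have h1 := (T i).le_opNorm h
    have h2 := abs_real_inner_le_norm (T i x) (T i h)
    have h3 : |inner ℝ (T i x) (T i h)| * ‖T i h‖ ^ 2 ≤
        (‖T i x‖ * (‖T i‖ * ‖h‖)) * (‖T i‖ * ‖h‖) ^ 2 := by
      gcongr
      exact h2.trans (by gcongr)
    have h4 : -(|inner ℝ (T i x) (T i h)| * ‖T i h‖ ^ 2) ≤
        inner ℝ (T i x) (T i h) * ‖T i h‖ ^ 2 := by
      have := neg_abs_le (inner ℝ (T i x) (T i h))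
      nlinarith [sq_nonneg ‖T i h‖]
    have h5 : 0 ≤ (‖T i h‖ ^ 2) ^ 2 := by positivity
    nlinarith
  have hδ : 0 < μ / (2 * (M + 1)) := by positivity
  filter_upwards [Metric.ball_mem_nhds x hδ] with y hy
  have hy' : ‖y - x‖ < μ / (2 * (M + 1)) := mem_ball_iff_norm.1 hy
  rw [lt_div_iff₀ (by positivity)] at hy'
  have hq := quartic_add T d x (y - x)
  rw [add_sub_cancel, hgrad, inner_zero_left] at hq
  have h1 := hrem (y - x)
  have h2 := hco (y - x)
  have h3 : M * ‖y - x‖ ^ 3 ≤ 1 / 2 * (μ * ‖y - x‖ ^ 2) := by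
    have hn := norm_nonneg (y - x)
    have : M * ‖y - x‖ ≤ 1 / 2 * μ := by nlinarith
    nlinarith [sq_nonneg ‖y - x‖]
  linarith

theorem quarticHess_add_smul (x u v : E) (t : ℝ) :
    inner ℝ (quarticHess T d (x + t • u) v) v = inner ℝ (quarticHess T d x v) v +
      t * (∑ i, (4 * inner ℝ (T i x) (T i u) * ‖T i v‖ ^ 2 +
        8 * inner ℝ (T i x) (T i v) * inner ℝ (T i u) (T i v))) +
      t ^ 2 * ∑ i, (2 * ‖T i u‖ ^ 2 * ‖T i v‖ ^ 2 + 4 * inner ℝ (T i u) (T i v) ^ 2) := by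
  simp only [inner_quarticHess, Finset.mul_sum, ← Finset.sum_add_distrib, norm_map_add_sq]
  simp only [map_add, map_smul, inner_add_left, real_inner_smul_left, real_inner_smul_right,
    norm_smul, mul_pow, Real.norm_eq_abs, sq_abs, real_inner_self_eq_norm_sq]
  refine Finset.sum_congr rfl fun i _ => ?_
  ring

/-- Any two nonzero directions are both moved by a common `Tᵢ`. -/
def Entangled (T : ι → E →L[ℝ] F) : Prop :=
  ∀ u v : E, u ≠ 0 → v ≠ 0 → ∃ i, T i u ≠ 0 ∧ T i v ≠ 0

variable {T d}

variable [FiniteDimensional ℝ E] [Nontrivial E]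

/-- The Hessian stays positive definite on the boundary of the majorant ball, since its quadratic
form is strictly convex along segments. -/
theorem IsAdmissible.posDef_of_mem_closedBall {x : E} {r c γ : ℝ} (hT : Entangled T)
    (h : IsAdmissible (quartic T d) x r c γ) (hα : alpha (quartic T d) x γ ≤ 1 / 2)
    (hr : rZero (quartic T d) x γ ≤ r) {y : E}
    (hy : y ∈ Metric.closedBall x (rZero (quartic T d) x γ)) :
    PosDef (hess (quartic T d) y) := by
  have hβ := h.beta_pos
  have hγ := h.gamma_pos
  have hx := Metric.mem_ball_self (x := x) h.r_pos
  rw [mem_closedBall_iff_norm] at hy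
  set u := y - x with hu
  rcases eq_or_ne u 0 with hu0 | hu0
  · rw [sub_eq_zero.1 hu0]; exact h.posDef x hx
  refine ⟨by rw [hess_quartic]; exact isSymmetric_quarticHess T d y, fun v hv => ?_⟩
  have hun : 0 < ‖u‖ := norm_pos_iff.2 hu0
  obtain ⟨hs, hsw, hw, hsum, -⟩ := majorant_roots h hα
  have hβr : γ * ‖u‖ ≤ 1 / beta (quartic T d) x := by
    have : rZero (quartic T d) x γ ≤ 1 / (beta (quartic T d) x * γ) := by
      have : 2 / (beta (quartic T d) x * γ) = 2 * (1 / (beta (quartic T d) x * γ)) := by ring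
      linarith
    calc γ * ‖u‖ ≤ γ * (1 / (beta (quartic T d) x * γ)) := by gcongr; linarith
      _ = _ := by field_simp
  set A := ∑ i, (2 * ‖T i u‖ ^ 2 * ‖T i v‖ ^ 2 + 4 * inner ℝ (T i u) (T i v) ^ 2) with hA
  set B := ∑ i, (4 * inner ℝ (T i x) (T i u) * ‖T i v‖ ^ 2 +
        8 * inner ℝ (T i x) (T i v) * inner ℝ (T i u) (T i v)) with hB
  have hApos : 0 < A := by
    obtain ⟨i, hi1, hi2⟩ := hT u v hu0 hv
    refine Finset.sum_pos' (fun i _ => by positivity) ⟨i, Finset.mem_univ _, ?_⟩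
    have := norm_pos_iff.2 hi1
    have := norm_pos_iff.2 hi2
    positivity
  have hx1 := (h.posDef x hx).coercive v
  change 1 / beta (quartic T d) x * ‖v‖ ^ 2 ≤ _ at hx1
  have hslope : ∀ t ∈ Set.Ioo (0 : ℝ) 1, -(γ * ‖u‖ * ‖v‖ ^ 2) ≤ B + t * A := by
    intro t ht
    have hmem : x + t • u ∈ Metric.ball x r := by
      rw [mem_ball_iff_norm, add_sub_cancel_left, norm_smul, Real.norm_of_nonneg ht.1.le]
      nlinarith [ht.2]
    have hl := h.lipschitz _ hmem x hx
    rw [add_sub_cancel_left, norm_smul, Real.norm_of_nonneg ht.1.le] at hl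
    have h1 := abs_real_inner_le_norm
      ((hess (quartic T d) (x + t • u) - hess (quartic T d) x) v) v
    have h2 := (hess (quartic T d) (x + t • u) - hess (quartic T d) x).le_opNorm v
    have h3 : |inner ℝ ((hess (quartic T d) (x + t • u) - hess (quartic T d) x) v) v| ≤
        γ * (t * ‖u‖) * ‖v‖ * ‖v‖ := by
      refine h1.trans ?_
      gcongr
      exact h2.trans (by gcongr)
    rw [sub_apply, inner_sub_left, hess_quartic, hess_quartic, quarticHess_add_smul] at h3
    have h4 := (abs_le.1 h3).1
    have h5 : 0 ≤ t * (B + t * A + γ * ‖u‖ * ‖v‖ ^ 2) := by nlinarith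
    have := nonneg_of_mul_nonneg_right h5 ht.1
    linarith
  -- Letting `t → 0⁺` frees the slope bound from `A`. At `t = 1` the form is then at least `(1/β -
  -- γ‖u‖)‖v‖² + A ≥ A > 0`.
  have hB0 : -(γ * ‖u‖ * ‖v‖ ^ 2) ≤ B := by
    have ht : Tendsto (fun t : ℝ => B + t * A) (𝓝[>] 0) (𝓝 (B + 0 * A)) :=
      ((continuous_const.add (continuous_id.mul continuous_const)).tendsto 0).mono_left
        nhdsWithin_le_nhds
    have := ge_of_tendsto ht (by
      filter_upwards [Ioo_mem_nhdsGT (zero_lt_one' ℝ)] with t ht using hslope t ht)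
    simpa using this
  have hfin := quarticHess_add_smul T d x u v 1
  rw [one_smul, hu, add_sub_cancel, ← hu, ← hA, ← hB, ← hess_quartic, ← hess_quartic] at hfin
  rw [hfin]
  have : γ * ‖u‖ * ‖v‖ ^ 2 ≤ 1 / beta (quartic T d) x * ‖v‖ ^ 2 := by gcongr
  linarith

theorem PosDef.isLocalMin_quartic {x : E} (hgrad : gradient (quartic T d) x = 0)
    (h : PosDef (hess (quartic T d) x)) : IsLocalMin (quartic T d) x := by
  have hpos := h.norm_inverse_pos
  refine SmoothStress.isLocalMin_quartic T d
    (μ := 1 / ‖(hess (quartic T d) x).inverse‖) (by positivity)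
    (by rw [← gradient_quartic]; exact hgrad) fun v => ?_
  rw [← hess_quartic]
  exact h.coercive v

/-- Certification of a local nonglobal minimizer of a quartic by Newton's method. -/
theorem IsAdmissible.newton_quartic {x z : E} {r c γ : ℝ} (hT : Entangled T)
    (hz : quartic T d z = 0)
    (h : IsAdmissible (quartic T d) x r c γ) (hα : alpha (quartic T d) x γ ≤ 1 / 2)
    (hr : rZero (quartic T d) x γ ≤ r) :
    (∀ k, (hess (quartic T d) (newton (quartic T d) x k)).IsInvertible) ∧
    ∃ y, Tendsto (newton (quartic T d) x) atTop (𝓝 y) ∧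
      y ∈ Metric.closedBall x (rZero (quartic T d) x γ) ∧
      gradient (quartic T d) y = 0 ∧
      (∀ k, ‖newton (quartic T d) x k - y‖ ≤ (2 * alpha (quartic T d) x γ) ^ 2 ^ k *
        (eta (quartic T d) x / alpha (quartic T d) x γ)) ∧
      (∀ w ∈ Metric.closedBall x r, gradient (quartic T d) w = 0 → w = y) ∧
      IsLngm (quartic T d) y := by
  have hd := differentiable_gradient_quartic T d
  obtain ⟨hinv, y, hlim, hy, hgrad, hrate⟩ := newton_kantorovich hd h hα hr
  have hyr := Metric.closedBall_subset_closedBall hr hy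
  refine ⟨hinv, y, hlim, hy, hgrad, hrate, fun w hw hgw =>
    eq_of_gradient_eq_zero h.r_pos hd h.posDef hw hyr hgw hgrad,
    (h.posDef_of_mem_closedBall hT hα hr hy).isLocalMin_quartic hgrad, fun hall => ?_⟩
  -- Since `y` may lie on the sphere, only the weak bound `c ≤ g y` survives by continuity; it
  -- suffices because `c > 0`.
  have h1 := h.le_of_mem_closedBall hyr
  have h2 := hall z
  have := h.c_pos
  linarith

end Quartic

/-! ### Reduction to centred coordinates -/

section Lift

variable {n d : ℕ}

theorem edm_apply (P : Config n d) (i j : Fin n) :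
    edm P i j = ∑ k, (toMat P i k - toMat P j k) ^ 2 := by
  simp only [edm, lindenstrauss, Matrix.sub_apply, Matrix.add_apply, Matrix.smul_apply,
    Matrix.vecMulVec_apply, Matrix.diag_apply, Matrix.mul_apply, Matrix.transpose_apply,
    Pi.one_apply, mul_one, one_mul, smul_eq_mul, Finset.mul_sum, ← Finset.sum_add_distrib,
    ← Finset.sum_sub_distrib]
  exact Finset.sum_congr rfl fun k _ => by ring

theorem toMat_lift (V : Matrix (Fin n) (Fin (n - 1)) ℝ) (L : Config (n - 1) d) :
    toMat (lift V L) = V * toMat L := rfl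

theorem toMat_ofMat (A : Matrix (Fin n) (Fin d) ℝ) : toMat (ofMat A) = A := rfl

theorem ofMat_toMat (P : Config n d) : ofMat (toMat P) = P := rfl

theorem toMat_add (P Q : Config n d) : toMat (P + Q) = toMat P + toMat Q := rfl

theorem toMat_smul (a : ℝ) (P : Config n d) : toMat (a • P) = a • toMat P := rfl

/-- The difference of the rows `i` and `j` of `V L`, as a function of `L`. -/
def rowDiff (d : ℕ) (V : Matrix (Fin n) (Fin (n - 1)) ℝ) (p : Fin n × Fin n) :
    Config (n - 1) d →L[ℝ] EuclideanSpace ℝ (Fin d) :=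
  LinearMap.toContinuousLinearMap
    { toFun := fun L => WithLp.toLp 2 fun k => toMat (lift V L) p.1 k - toMat (lift V L) p.2 k
      map_add' := fun L M => by
        ext k
        simp only [toMat_lift, toMat_add, Matrix.mul_add, Matrix.add_apply, PiLp.add_apply]
        ring
      map_smul' := fun a L => by
        ext k
        simp only [toMat_lift, toMat_smul, Matrix.mul_smul, Matrix.smul_apply, PiLp.smul_apply,
          smul_eq_mul, RingHom.id_apply]
        ring }

theorem rowDiff_apply (V : Matrix (Fin n) (Fin (n - 1)) ℝ) (i j : Fin n) (L : Config (n - 1) d)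
    (k : Fin d) :
    rowDiff d V (i, j) L k = toMat (lift V L) i k - toMat (lift V L) j k := rfl

theorem fL_eq_quartic (V : Matrix (Fin n) (Fin (n - 1)) ℝ) (D : Matrix (Fin n) (Fin n) ℝ) :
    fL (d := d) V D = quartic (rowDiff d V) (fun p => D p.1 p.2) := by
  funext L
  simp only [fL, f, frobSq, quartic, Fintype.sum_prod_type, Matrix.sub_apply, edm_apply,
    EuclideanSpace.norm_sq_eq, rowDiff_apply, Real.norm_eq_abs, sq_abs]

variable {V : Matrix (Fin n) (Fin (n - 1)) ℝ}

/-- Appending the column `e/√n` to `V` gives a square matrix with orthonormal columns, so its rows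
are orthonormal as well. -/
theorem IsCentering.mul_transpose (hV : IsCentering V) (hn : 0 < n) :
    V * V.transpose + Matrix.of (fun _ _ => 1 / (n : ℝ)) = 1 := by
  have hn' : (0 : ℝ) < n := by exact_mod_cast hn
  set e : Matrix (Fin n) Unit ℝ := Matrix.of fun _ _ => 1 / Real.sqrt n with he
  have hVe : V.transpose * e = 0 := by
    ext i j
    have := congrFun hV.2 i
    simp only [Matrix.mulVec, dotProduct, Pi.one_apply, mul_one, Pi.zero_apply] at this
    rw [Matrix.mul_apply]
    simp only [he, Matrix.of_apply, ← Finset.sum_mul, this, zero_mul, Matrix.zero_apply]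
  have hee : e.transpose * e = 1 := by
    ext i j
    simp [Matrix.mul_apply, he, ← mul_inv, hn'.ne']
  have hQ : (Matrix.fromCols V e).transpose * Matrix.fromCols V e = 1 := by
    rw [Matrix.transpose_fromCols, Matrix.fromRows_mul_fromCols, hV.1, hVe, hee]
    have : e.transpose * V = 0 := by
      rw [← Matrix.transpose_transpose V, ← Matrix.transpose_mul, hVe, Matrix.transpose_zero]
    rw [this, Matrix.fromBlocks_one]
  have hcard : Fintype.card (Fin (n - 1) ⊕ Unit) = Fintype.card (Fin n) := by
    simp; omega
  rw [Matrix.mul_eq_one_comm_of_card_eq _ _ _ hcard] at hQ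
  rw [Matrix.transpose_fromCols, Matrix.fromCols_mul_fromRows] at hQ
  rw [← hQ]
  congr 1
  ext i j
  simp [Matrix.mul_apply, he, ← mul_inv]

/-- The coordinates `Vᵀ P`. -/
def drop (V : Matrix (Fin n) (Fin (n - 1)) ℝ) (P : Config n d) : Config (n - 1) d :=
  ofMat (V.transpose * toMat P)

theorem IsCentering.drop_lift (hV : IsCentering V) (L : Config (n - 1) d) :
    drop V (lift V L) = L := by
  rw [drop, toMat_lift, ← Matrix.mul_assoc, hV.1, Matrix.one_mul, ofMat_toMat]

theorem IsCentering.isCentered_lift (hV : IsCentering V) (L : Config (n - 1) d) :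
    IsCentered (lift V L) := by
  rw [IsCentered, toMat_lift, Matrix.transpose_mul, ← Matrix.mulVec_mulVec, hV.2,
    Matrix.mulVec_zero]

theorem IsCentered.sum_eq_zero {P : Config n d} (hP : IsCentered P) (k : Fin d) :
    ∑ i, toMat P i k = 0 := by
  have := congrFun hP k
  simpa [Matrix.mulVec, dotProduct] using this

theorem IsCentering.lift_drop_apply (hV : IsCentering V) (P : Config n d) (i : Fin n)
    (k : Fin d) :
    toMat (lift V (drop V P)) i k = toMat P i k - (∑ j, toMat P j k) / n := by
  have h := hV.mul_transpose i.pos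
  rw [toMat_lift, drop, toMat_ofMat, ← Matrix.mul_assoc, eq_sub_of_add_eq h, Matrix.sub_mul,
    Matrix.one_mul, Matrix.sub_apply, Matrix.mul_apply]
  simp [← Finset.mul_sum, div_eq_inv_mul]

theorem IsCentering.edm_lift_drop (hV : IsCentering V) (P : Config n d) :
    edm (lift V (drop V P)) = edm P := by
  ext i j
  simp only [edm_apply, hV.lift_drop_apply]
  exact Finset.sum_congr rfl fun k _ => by ring

theorem IsCentering.fL_drop (hV : IsCentering V) (D : Matrix (Fin n) (Fin n) ℝ)
    (P : Config n d) : fL V D (drop V P) = f D P := by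
  rw [fL, f, hV.edm_lift_drop, f]

theorem f_edm_self (P : Config n d) : f (edm P) P = 0 := by
  simp [f, frobSq]

theorem IsCentering.eq_zero_of_rowDiff (hV : IsCentering V) {u : Config (n - 1) d} (i : Fin n)
    (h : ∀ j, rowDiff d V (i, j) u = 0) : u = 0 := by
  have hP : lift V u = 0 := by
    ext ⟨j, k⟩
    have hc : ∀ j, toMat (lift V u) j k = toMat (lift V u) i k := fun j => by
      have := congrArg (fun w : EuclideanSpace ℝ (Fin d) => w k) (h j)
      simp only [rowDiff_apply, PiLp.zero_apply] at this
      linarith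
    have hs := (hV.isCentered_lift u).sum_eq_zero k
    simp_rw [hc] at hs
    have hn : (n : ℝ) ≠ 0 := by exact_mod_cast i.pos.ne'
    simp [hn] at hs
    exact (hc j).trans hs
  rw [← hV.drop_lift u, hP, drop]
  ext ⟨j, k⟩
  simp [ofMat, toMat, Matrix.mul_apply]

/-- Choose `i, j` whose difference `u` moves. For every `k`, `u` moves `(i, k)` or `(j, k)`. If `v`
vanished on all pairs moved by `u`, its rows `i` and `k` would agree for every `k`; being centred,
`v` would be `0`. -/
theorem IsCentering.entangled (hV : IsCentering V) : Entangled (rowDiff d V) := by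
  intro u v hu hv
  by_contra! hcon
  have hsub : ∀ (w : Config (n - 1) d) (i j k : Fin n),
      rowDiff d V (i, k) w - rowDiff d V (j, k) w = rowDiff d V (i, j) w := by
    intro w i j k
    ext l
    simp only [PiLp.sub_apply, rowDiff_apply]
    ring
  have hu' : ∃ i j, rowDiff d V (i, j) u ≠ 0 := by
    by_contra! h
    rcases Nat.eq_zero_or_pos n with rfl | hn
    · exact hu (by ext ⟨l, _⟩; exact absurd l.isLt (by simp))
    · exact hu (hV.eq_zero_of_rowDiff ⟨0, hn⟩ fun j => h _ j)
  obtain ⟨i, j, hij⟩ := hu'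
  refine hv (hV.eq_zero_of_rowDiff i fun k => ?_)
  by_cases hik : rowDiff d V (i, k) u = 0
  · have hjk : rowDiff d V (j, k) u ≠ 0 := by
      intro h
      apply hij
      rw [← hsub u i j k, hik, h, sub_zero]
    have h1 := hcon (i, j) hij
    have h2 := hcon (j, k) hjk
    rw [← hsub v i j k, h2, sub_zero] at h1
    exact h1
  · exact hcon _ hik

/-- The map `drop V` is a continuous left inverse of `lift V`, and `fL ∘ drop V = f` by translation
invariance. Hence local minimality pulls back to all configurations, centred or not. -/
theorem IsCentering.isLngm_lift (hV : IsCentering V) {D : Matrix (Fin n) (Fin n) ℝ}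
    {L : Config (n - 1) d} (hL : IsLngm (fL V D) L) : IsLngm (f D) (lift V L) := by
  refine ⟨?_, fun h => hL.2 fun M => h (lift V M)⟩
  have hcont : Continuous (drop V : Config n d → Config (n - 1) d) := by
    unfold drop ofMat
    refine (PiLp.continuous_toLp 2 _).comp (continuous_pi fun ij => ?_)
    simp only [Matrix.mul_apply, toMat, Matrix.of_apply]
    fun_prop
  have ht : Tendsto (drop V) (𝓝 (lift V L)) (𝓝 L) := by
    have := hcont.tendsto (lift V L)
    rwa [hV.drop_lift] at this
  filter_upwards [ht.eventually hL.1] with P hP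
  rwa [hV.fL_drop] at hP

/-- In a trivial space the centre would coincide with the true configuration, where the objective is
`0`, against the positive lower bound. -/
theorem IsAdmissible.nontrivial (hV : IsCentering V) {P : Config n d} {L : Config (n - 1) d}
    {r c γ : ℝ} (h : IsAdmissible (fL V (edm P)) L r c γ) : Nontrivial (Config (n - 1) d) := by
  by_contra hc
  rw [not_nontrivial_iff_subsingleton] at hc
  have h1 := h.lower L (Metric.mem_ball_self h.r_pos)
  rw [Subsingleton.elim L (drop V P), hV.fL_drop, f_edm_self] at h1
  exact absurd h1 h.c_pos.not_gt

theorem rZero_le_rOne {m : ℕ} [Nontrivial (Config m d)] {g : Config m d → ℝ} {x : Config m d}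
    {r c γ : ℝ} (h : IsAdmissible g x r c γ) (hα : alpha g x γ ≤ 1 / 2)
    (hr : rZero g x γ ≤ r) : rZero g x γ ≤ rOne g x r γ :=
  le_min hr (majorant_roots h hα).2.1

theorem stress_newton (n d : ℕ) (V : Matrix (Fin n) (Fin (n - 1)) ℝ) (Pbar : Config n d)
    (g : Config (n - 1) d → ℝ) (Lt : Config (n - 1) d) (r c γ : ℝ)
    (hV : IsCentering V) (hg : g = fL V (edm Pbar))
    (h : IsAdmissible g Lt r c γ) (hα : alpha g Lt γ ≤ 1 / 2) (hr : rZero g Lt γ ≤ r) :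
    (∀ k, (hess g (newton g Lt k)).IsInvertible) ∧
    ∃ Ls, Tendsto (newton g Lt) atTop (𝓝 Ls) ∧
      Ls ∈ Metric.closedBall Lt (rZero g Lt γ) ∧
      gradient g Ls = 0 ∧
      (∀ k, ‖newton g Lt k - Ls‖ ≤ (2 * alpha g Lt γ) ^ 2 ^ k * (eta g Lt / alpha g Lt γ)) ∧
      (∀ L ∈ Metric.closedBall Lt r, gradient g L = 0 → L = Ls) ∧ IsLngm g Ls := by
  subst hg
  have := h.nontrivial hV
  have hz := hV.fL_drop (edm Pbar) Pbar
  rw [f_edm_self] at hz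
  rw [fL_eq_quartic] at *
  exact h.newton_quartic hV.entangled hz hα hr

end Lift

/-! ### Configurations on a line: the Hessian as a weighted Laplacian -/

section Line

variable {n : ℕ} {V : Matrix (Fin n) (Fin (n - 1)) ℝ}

/-- The points on the line of the configuration `V L`. -/
def pts (V : Matrix (Fin n) (Fin (n - 1)) ℝ) (L : Config (n - 1) 1) (i : Fin n) : ℝ :=
  toMat (lift V L) i 0

theorem pts_add (L M : Config (n - 1) 1) (i : Fin n) : pts V (L + M) i = pts V L i + pts V M i := by
  simp [pts, toMat_lift, toMat_add, Matrix.mul_add]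

theorem pts_sub (L M : Config (n - 1) 1) (i : Fin n) : pts V (L - M) i = pts V L i - pts V M i := by
  have := pts_add (V := V) (L - M) M i
  rw [sub_add_cancel] at this
  linarith

theorem inner_rowDiff_one (L M : Config (n - 1) 1) (p : Fin n × Fin n) :
    inner ℝ (rowDiff 1 V p L) (rowDiff 1 V p M) =
      (pts V L p.1 - pts V L p.2) * (pts V M p.1 - pts V M p.2) := by
  obtain ⟨i, j⟩ := p
  rw [PiLp.inner_apply, Fin.sum_univ_one]
  simp only [rowDiff_apply, pts, RCLike.inner_apply, conj_trivial]
  ring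

theorem norm_rowDiff_one_sq (L : Config (n - 1) 1) (p : Fin n × Fin n) :
    ‖rowDiff 1 V p L‖ ^ 2 = (pts V L p.1 - pts V L p.2) ^ 2 := by
  rw [← real_inner_self_eq_norm_sq, inner_rowDiff_one, sq]

theorem IsCentering.sum_pts (hV : IsCentering V) (L : Config (n - 1) 1) :
    ∑ i, pts V L i = 0 :=
  (hV.isCentered_lift L).sum_eq_zero 0

theorem IsCentering.sum_pts_sq (hV : IsCentering V) (L : Config (n - 1) 1) :
    ∑ i, pts V L i ^ 2 = ‖L‖ ^ 2 := by
  have h : (V * toMat L).transpose * (V * toMat L) = (toMat L).transpose * toMat L := by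
    rw [Matrix.transpose_mul, Matrix.mul_assoc, ← Matrix.mul_assoc V.transpose, hV.1,
      Matrix.one_mul]
  have h0 := congrFun (congrFun h 0) 0
  simp only [Matrix.mul_apply (M := Matrix.transpose _), Matrix.transpose_apply] at h0
  rw [EuclideanSpace.norm_sq_eq, Fintype.sum_prod_type]
  simp only [Fin.sum_univ_one, Real.norm_eq_abs, sq_abs]
  simp only [pts, toMat_lift, sq]
  exact h0

theorem IsCentering.abs_pts_le (hV : IsCentering V) (L : Config (n - 1) 1) (i : Fin n) :
    |pts V L i| ≤ ‖L‖ := by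
  refine abs_le_of_sq_le_sq ?_ (norm_nonneg L)
  rw [← hV.sum_pts_sq]
  exact Finset.single_le_sum (f := fun i => pts V L i ^ 2) (fun j _ => sq_nonneg _)
    (Finset.mem_univ i)

theorem IsCentering.abs_pts_sub_le (hV : IsCentering V) (L : Config (n - 1) 1) (i j : Fin n) :
    |pts V L i - pts V L j| ≤ 2 * ‖L‖ := by
  have := abs_sub (pts V L i) (pts V L j)
  linarith [hV.abs_pts_le L i, hV.abs_pts_le L j]

theorem IsCentering.sum_pts_sub_sq (hV : IsCentering V) (L : Config (n - 1) 1) :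
    ∑ p : Fin n × Fin n, (pts V L p.1 - pts V L p.2) ^ 2 = 2 * n * ‖L‖ ^ 2 := by
  have h : ∀ i, ∑ j, (pts V L i - pts V L j) ^ 2 = n * pts V L i ^ 2 + ‖L‖ ^ 2 := by
    intro i
    simp only [sub_sq, Finset.sum_add_distrib, Finset.sum_sub_distrib, ← Finset.mul_sum,
      hV.sum_pts, hV.sum_pts_sq]
    simp
  rw [Fintype.sum_prod_type]
  simp only [h, Finset.sum_add_distrib, ← Finset.mul_sum, hV.sum_pts_sq]
  simp
  ring

theorem inner_quarticHess_one (c : Fin n × Fin n → ℝ) (L h k : Config (n - 1) 1) :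
    inner ℝ (quarticHess (rowDiff 1 V) c L h) k =
      ∑ p : Fin n × Fin n, (6 * (pts V L p.1 - pts V L p.2) ^ 2 - 2 * c p) *
        ((pts V h p.1 - pts V h p.2) * (pts V k p.1 - pts V k p.2)) := by
  rw [inner_quarticHess]
  refine Finset.sum_congr rfl fun p _ => ?_
  rw [norm_rowDiff_one_sq, inner_rowDiff_one, inner_rowDiff_one, inner_rowDiff_one]
  ring

/-- The edge weights differ by `6(a² - b²) = 6(a + b)(a - b)`, with `|a + b| ≤ R` and `|a - b| ≤ 2‖L
- M‖`. Cauchy–Schwarz over the pairs, with `∑ (hᵢ - hⱼ)² = 2n‖h‖²`, supplies the remaining factor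
`2n`. -/
theorem IsCentering.norm_quarticHess_sub_le (hV : IsCentering V) (c : Fin n × Fin n → ℝ)
    {L M : Config (n - 1) 1} {R : ℝ} (hR : 0 ≤ R)
    (hLM : ∀ i j, |(pts V L i - pts V L j) + (pts V M i - pts V M j)| ≤ R) :
    ‖quarticHess (rowDiff 1 V) c L - quarticHess (rowDiff 1 V) c M‖ ≤
      24 * n * R * ‖L - M‖ := by
  refine ContinuousLinearMap.opNorm_le_bound _ (by positivity) fun h => ?_
  set k := (quarticHess (rowDiff 1 V) c L - quarticHess (rowDiff 1 V) c M) h with hk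
  have h1 : ‖k‖ ^ 2 ≤ 12 * R * ‖L - M‖ * (2 * n * (‖h‖ * ‖k‖)) := by
    calc ‖k‖ ^ 2 = inner ℝ k k := (real_inner_self_eq_norm_sq k).symm
      _ = ∑ p : Fin n × Fin n, 6 * (((pts V L p.1 - pts V L p.2) + (pts V M p.1 - pts V M p.2)) *
          (pts V (L - M) p.1 - pts V (L - M) p.2)) *
          ((pts V h p.1 - pts V h p.2) * (pts V k p.1 - pts V k p.2)) := by
        conv_lhs => rw [hk, sub_apply, inner_sub_left, ← sub_apply, ← hk]
        rw [inner_quarticHess_one, inner_quarticHess_one, ← Finset.sum_sub_distrib]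
        refine Finset.sum_congr rfl fun p _ => ?_
        rw [pts_sub, pts_sub]
        ring
      _ ≤ ∑ p : Fin n × Fin n, 12 * R * ‖L - M‖ *
          (|pts V h p.1 - pts V h p.2| * |pts V k p.1 - pts V k p.2|) := by
        refine Finset.sum_le_sum fun p _ => (le_abs_self _).trans ?_
        rw [abs_mul, abs_mul, abs_mul, abs_mul]
        have h2 := hLM p.1 p.2
        have h3 := hV.abs_pts_sub_le (L - M) p.1 p.2
        have h4 := mul_le_mul h2 h3 (abs_nonneg _) hR
        have : |(6 : ℝ)| = 6 := by norm_num
        rw [this]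
        have h5 := mul_le_mul_of_nonneg_left h4 (by norm_num : (0 : ℝ) ≤ 6)
        rw [show 12 * R * ‖L - M‖ = 6 * (R * (2 * ‖L - M‖)) by ring]
        gcongr
      _ ≤ 12 * R * ‖L - M‖ * (2 * n * (‖h‖ * ‖k‖)) := by
        rw [← Finset.mul_sum]
        gcongr
        refine (Real.sum_mul_le_sqrt_mul_sqrt _ _ _).trans (le_of_eq ?_)
        simp only [sq_abs, hV.sum_pts_sub_sq]
        rw [← Real.sqrt_mul (by positivity), show 2 * (n : ℝ) * ‖h‖ ^ 2 * (2 * n * ‖k‖ ^ 2) =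
          (2 * n * (‖h‖ * ‖k‖)) ^ 2 by ring, Real.sqrt_sq (by positivity)]
  rcases (norm_nonneg k).eq_or_lt with h0 | h0
  · rw [← h0]; positivity
  · have : ‖k‖ * ‖k‖ ≤ (24 * n * R * ‖L - M‖ * ‖h‖) * ‖k‖ := by
      refine le_trans (le_of_eq (sq _).symm) (h1.trans (le_of_eq ?_))
      ring
    exact le_of_mul_le_mul_right this h0

/-- Write each summand at `y` as `½(ρ + δ)²` with residual `ρ ≥ -a`, discard `½δ²`, and bound the
second-order part of `ρδ` below by `-a ‖Tₚ(y - x)‖²`. -/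
theorem IsCentering.quartic_lower_bound (hV : IsCentering V) {c : Fin n × Fin n → ℝ}
    {x : Config (n - 1) 1} {a : ℝ}
    (ha : ∀ p : Fin n × Fin n, -a ≤ (pts V x p.1 - pts V x p.2) ^ 2 - c p)
    (y : Config (n - 1) 1) :
    quartic (rowDiff 1 V) c x - ‖quarticGrad (rowDiff 1 V) c x‖ * ‖y - x‖ -
      2 * n * a * ‖y - x‖ ^ 2 ≤ quartic (rowDiff 1 V) c y := by
  set T := rowDiff 1 V
  have hq : quartic T c x + inner ℝ (quarticGrad T c x) (y - x) -
      2 * n * a * ‖y - x‖ ^ 2 ≤ quartic T c y := by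
    have hs := hV.sum_pts_sub_sq (y - x)
    have e : 2 * n * a * ‖y - x‖ ^ 2 = ∑ p : Fin n × Fin n, a * ‖T p (y - x)‖ ^ 2 := by
      simp only [T, norm_rowDiff_one_sq]
      rw [← Finset.mul_sum, hs]
      ring
    nth_rewrite 3 [← add_sub_cancel x y]
    rw [e, inner_quarticGrad, quartic, quartic, Finset.mul_sum, Finset.mul_sum,
      ← Finset.sum_add_distrib, ← Finset.sum_sub_distrib]
    refine Finset.sum_le_sum fun p _ => ?_
    have hap := ha p
    rw [← norm_rowDiff_one_sq] at hap
    rw [norm_map_add_sq]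
    have h1 := mul_nonneg (sub_nonneg.2 hap) (sq_nonneg ‖T p (y - x)‖)
    nlinarith [sq_nonneg (2 * inner ℝ (T p x) (T p (y - x)) + ‖T p (y - x)‖ ^ 2)]
  have h3 := (abs_le.1 (abs_real_inner_le_norm (quarticGrad T c x) (y - x))).1
  linarith

theorem isAdmissible_of_coercive {c : Fin n × Fin n → ℝ} {x : Config (n - 1) 1}
    {r m γ b : ℝ} (hr : 0 < r) (hm : 0 < m) (hγ : 0 < γ) (hb : γ * r < b)
    (hco : ∀ v, b * ‖v‖ ^ 2 ≤ inner ℝ (quarticHess (rowDiff 1 V) c x v) v)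
    (hlip : ∀ y ∈ Metric.ball x r, ∀ z ∈ Metric.ball x r,
      ‖quarticHess (rowDiff 1 V) c y - quarticHess (rowDiff 1 V) c z‖ ≤ γ * ‖y - z‖)
    (hlow : ∀ y ∈ Metric.ball x r, m < quartic (rowDiff 1 V) c y) :
    IsAdmissible (quartic (rowDiff 1 V) c) x r m γ := by
  refine ⟨hr, hm, hγ, fun y hy => ⟨?_, fun v hv => ?_⟩, hlow, fun y hy z hz => ?_⟩
  · rw [hess_quartic]
    exact isSymmetric_quarticHess _ _ y
  · rw [hess_quartic]
    have h1 := hco v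
    have h2 := hlip y hy x (Metric.mem_ball_self hr)
    have h3 : ‖y - x‖ < r := mem_ball_iff_norm.1 hy
    have h4 := (abs_le.1 (abs_real_inner_le_norm ((quarticHess (rowDiff 1 V) c y -
      quarticHess (rowDiff 1 V) c x) v) v)).1
    have h5 := (quarticHess (rowDiff 1 V) c y - quarticHess (rowDiff 1 V) c x).le_opNorm v
    have h6 : ‖(quarticHess (rowDiff 1 V) c y - quarticHess (rowDiff 1 V) c x) v‖ * ‖v‖ ≤
        γ * r * ‖v‖ * ‖v‖ := by
      gcongr
      refine h5.trans ?_
      gcongr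
      exact h2.trans (by gcongr)
    rw [sub_apply, inner_sub_left] at h4
    rw [sub_apply] at h6
    have : 0 < ‖v‖ ^ 2 := pow_pos (norm_pos_iff.2 hv) 2
    nlinarith
  · rw [hess_quartic, hess_quartic]
    exact hlip y hy z hz

end Line

/-! ### The three-cluster example with fifty points -/

section Witness

/-- Fifty points in clusters of sizes `35`, `14` and `1`. -/
def cluster (i : Fin 50) : Fin 3 :=
  if i.val < 35 then 0 else if i.val < 49 then 1 else 2

/-- Positions of the clusters at an approximate critical point. -/
def approxPos : Fin 3 → ℝ := ![0, 1.82632454, -2.92762653]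

/-- Positions of the clusters at the global minimizer. -/
def truePos : Fin 3 → ℝ := ![0, 2.15, 4.451]

def clusterConfig (a : Fin 3 → ℝ) : Config 50 1 := ofMat (Matrix.of fun i _ => a (cluster i))

theorem sum_cluster (φ : Fin 3 → ℝ) : ∑ i, φ (cluster i) = 35 * φ 0 + 14 * φ 1 + φ 2 := by
  have h0 : (Finset.univ.filter fun i => cluster i = 0).card = 35 := by decide
  have h1 : (Finset.univ.filter fun i => cluster i = 1).card = 14 := by decide
  have h2 : (Finset.univ.filter fun i => cluster i = 2).card = 1 := by decide
  rw [← Finset.sum_fiberwise Finset.univ cluster (fun i => φ (cluster i))]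
  have h : ∀ c, ∑ i with cluster i = c, φ (cluster i) =
      ((Finset.univ.filter fun i => cluster i = c).card : ℝ) * φ c := by
    intro c
    rw [← nsmul_eq_mul, ← Finset.sum_const]
    exact Finset.sum_congr rfl fun i hi => by rw [(Finset.mem_filter.1 hi).2]
  simp only [h, Fin.sum_univ_three, h0, h1, h2]
  norm_num

theorem card_cluster_le (i : Fin 50) :
    (Finset.univ.filter fun j => cluster i = cluster j).card ≤ 35 := by
  revert i
  decide

/-- Expanding the square, the cross terms add up to a sum of squared cluster totals and enter with a
negative sign; the constant is twice the largest cluster size. -/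
theorem sum_same_cluster_le (p : Fin 50 → ℝ) :
    ∑ i, ∑ j, (if cluster i = cluster j then (p i - p j) ^ 2 else 0) ≤ 70 * ∑ i, p i ^ 2 := by
  have h1 : ∑ i, ∑ j, (if cluster i = cluster j then p i ^ 2 else 0) ≤ 35 * ∑ i, p i ^ 2 := by
    rw [Finset.mul_sum]
    refine Finset.sum_le_sum fun i _ => ?_
    rw [← Finset.sum_filter, Finset.sum_const, nsmul_eq_mul]
    gcongr
    exact_mod_cast card_cluster_le i
  have h2 : ∑ i, ∑ j, (if cluster i = cluster j then p j ^ 2 else 0) =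
      ∑ i, ∑ j, (if cluster i = cluster j then p i ^ 2 else 0) := by
    rw [Finset.sum_comm]
    simp only [eq_comm]
  have h3 : 0 ≤ ∑ i, ∑ j, (if cluster i = cluster j then p i * p j else 0) := by
    have : ∑ i, ∑ j, (if cluster i = cluster j then p i * p j else 0) =
        ∑ c, (∑ i, if cluster i = c then p i else 0) ^ 2 := by
      simp only [sq, Finset.sum_mul_sum]
      conv_rhs => rw [Finset.sum_comm]
      refine Finset.sum_congr rfl fun i _ => ?_
      conv_rhs => rw [Finset.sum_comm]
      refine Finset.sum_congr rfl fun j _ => ?_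
      simp only [ite_mul, zero_mul, Finset.sum_ite_eq, Finset.mem_univ, if_true]
      simp only [mul_ite, mul_zero, eq_comm]
    rw [this]
    positivity
  have h4 : ∑ i, ∑ j, (if cluster i = cluster j then (p i - p j) ^ 2 else 0) =
      ∑ i, ∑ j, (if cluster i = cluster j then p i ^ 2 else 0) +
      ∑ i, ∑ j, (if cluster i = cluster j then p j ^ 2 else 0) -
      2 * ∑ i, ∑ j, (if cluster i = cluster j then p i * p j else 0) := by
    simp only [Finset.mul_sum, ← Finset.sum_add_distrib, ← Finset.sum_sub_distrib]
    refine Finset.sum_congr rfl fun i _ => Finset.sum_congr rfl fun j _ => ?_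
    split_ifs
    · ring
    · ring
  linarith

variable {V : Matrix (Fin 50) (Fin (50 - 1)) ℝ}

theorem IsCentering.pts_drop_sub (hV : IsCentering V) (a : Fin 3 → ℝ) (i j : Fin 50) :
    pts V (drop V (clusterConfig a)) i - pts V (drop V (clusterConfig a)) j =
      a (cluster i) - a (cluster j) := by
  rw [pts, pts, hV.lift_drop_apply, hV.lift_drop_apply]
  simp [clusterConfig, toMat_ofMat]

/-- The squared distances at the global minimizer. -/
def sqDist (p : Fin 50 × Fin 50) : ℝ := (truePos (cluster p.1) - truePos (cluster p.2)) ^ 2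

theorem edm_truePos (i j : Fin 50) : edm (clusterConfig truePos) i j = sqDist (i, j) := by
  rw [edm_apply, Fin.sum_univ_one]
  rfl

theorem IsCentering.fL_truePos (hV : IsCentering V) :
    fL V (edm (lift V (drop V (clusterConfig truePos)))) = quartic (rowDiff 1 V) sqDist := by
  rw [hV.edm_lift_drop, fL_eq_quartic]
  simp only [edm_truePos]

theorem IsCentering.quartic_approx (hV : IsCentering V) :
    2.6 * 10 ^ 3 < quartic (rowDiff 1 V) sqDist (drop V (clusterConfig approxPos)) := by
  simp only [quartic, norm_rowDiff_one_sq, hV.pts_drop_sub, sqDist, Fintype.sum_prod_type]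
  rw [Finset.sum_congr rfl fun i _ => sum_cluster fun c => ((approxPos (cluster i) -
    approxPos c) ^ 2 - (truePos (cluster i) - truePos c) ^ 2) ^ 2, sum_cluster fun b =>
    35 * ((approxPos b - approxPos 0) ^ 2 - (truePos b - truePos 0) ^ 2) ^ 2 +
    14 * ((approxPos b - approxPos 1) ^ 2 - (truePos b - truePos 1) ^ 2) ^ 2 +
    ((approxPos b - approxPos 2) ^ 2 - (truePos b - truePos 2) ^ 2) ^ 2]
  simp [approxPos, truePos]
  norm_num

theorem IsCentering.sumDist_approx (hV : IsCentering V) :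
    2127.8 < sumDist (lift V (drop V (clusterConfig approxPos))) ∧
      sumDist (lift V (drop V (clusterConfig approxPos))) < 2127.9 := by
  have h : sumDist (lift V (drop V (clusterConfig approxPos))) =
      ∑ i, ∑ j, |approxPos (cluster i) - approxPos (cluster j)| := by
    refine Finset.sum_congr rfl fun i _ => Finset.sum_congr rfl fun j _ => ?_
    rw [Fin.sum_univ_one, Real.sqrt_sq_eq_abs, ← hV.pts_drop_sub]
    rfl
  rw [h, Finset.sum_congr rfl fun i _ => sum_cluster fun c => |approxPos (cluster i) -
    approxPos c|, sum_cluster fun b => 35 * |approxPos b - approxPos 0| +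
    14 * |approxPos b - approxPos 1| + |approxPos b - approxPos 2|]
  simp [approxPos]
  norm_num [abs_of_pos, abs_of_neg]

/-- Edges inside a cluster have weight `0` and all others at least `10`. The full sum of squared
differences is `100‖v‖²` and clusters take at most `70‖v‖²` of it, leaving `10 · (100 - 70) = 300`.
-/
theorem IsCentering.coercive_approx (hV : IsCentering V) (v : Config (50 - 1) 1) :
    300 * ‖v‖ ^ 2 ≤ inner ℝ
      (quarticHess (rowDiff 1 V) sqDist (drop V (clusterConfig approxPos)) v) v := by
  have hw : ∀ b c : Fin 3, (if b = c then 0 else (10 : ℝ)) ≤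
      6 * (approxPos b - approxPos c) ^ 2 - 2 * (truePos b - truePos c) ^ 2 := by
    intro b c
    fin_cases b <;> fin_cases c <;> simp [approxPos, truePos] <;> norm_num
  have h1 := sum_same_cluster_le (pts V v)
  rw [hV.sum_pts_sq] at h1
  have h2 := hV.sum_pts_sub_sq v
  rw [inner_quarticHess_one]
  have h3 : ∑ p : Fin 50 × Fin 50, (if cluster p.1 = cluster p.2 then 0 else (10 : ℝ)) *
      (pts V v p.1 - pts V v p.2) ^ 2 = 10 * ∑ p : Fin 50 × Fin 50,
        (pts V v p.1 - pts V v p.2) ^ 2 - 10 * ∑ i, ∑ j,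
        (if cluster i = cluster j then (pts V v i - pts V v j) ^ 2 else 0) := by
    simp only [Fintype.sum_prod_type, Finset.mul_sum, ← Finset.sum_sub_distrib]
    refine Finset.sum_congr rfl fun i _ => Finset.sum_congr rfl fun j _ => ?_
    split_ifs <;> ring
  have h4 : ∑ p : Fin 50 × Fin 50, (if cluster p.1 = cluster p.2 then 0 else (10 : ℝ)) *
      (pts V v p.1 - pts V v p.2) ^ 2 ≤ ∑ p : Fin 50 × Fin 50,
      (6 * (pts V (drop V (clusterConfig approxPos)) p.1 -
        pts V (drop V (clusterConfig approxPos)) p.2) ^ 2 - 2 * sqDist p) *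
        ((pts V v p.1 - pts V v p.2) * (pts V v p.1 - pts V v p.2)) := by
    refine Finset.sum_le_sum fun p _ => ?_
    rw [hV.pts_drop_sub, ← sq]
    exact mul_le_mul_of_nonneg_right (hw _ _) (sq_nonneg _)
  push_cast at h2
  linarith

/-- The force on a point of cluster `b` at the approximate critical point. -/
def force (b : Fin 3) : ℝ :=
  ∑ j, 4 * ((approxPos b - approxPos (cluster j)) ^ 2 - (truePos b - truePos (cluster j)) ^ 2) *
    (approxPos b - approxPos (cluster j))

theorem sum_force_sq_lt : ∑ i, force (cluster i) ^ 2 < (1.8 / 10 ^ 3) ^ 2 := by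
  rw [sum_cluster fun b => force b ^ 2]
  have h : ∀ b, force b = _ := fun b => sum_cluster fun c =>
    4 * ((approxPos b - approxPos c) ^ 2 - (truePos b - truePos c) ^ 2) *
      (approxPos b - approxPos c)
  simp only [h]
  simp [approxPos, truePos]
  norm_num

theorem IsCentering.inner_grad_approx (hV : IsCentering V) (v : Config (50 - 1) 1) :
    inner ℝ (quarticGrad (rowDiff 1 V) sqDist (drop V (clusterConfig approxPos))) v =
      ∑ i, force (cluster i) * pts V v i := by
  rw [inner_quarticGrad, Fintype.sum_prod_type]
  simp only [norm_rowDiff_one_sq, inner_rowDiff_one, hV.pts_drop_sub, sqDist]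
  set φ : Fin 50 → Fin 50 → ℝ := fun i j => 2 * ((approxPos (cluster i) -
    approxPos (cluster j)) ^ 2 - (truePos (cluster i) - truePos (cluster j)) ^ 2) *
    (approxPos (cluster i) - approxPos (cluster j)) with hφ
  have h1 : ∀ i, force (cluster i) = 2 * ∑ j, φ i j := by
    intro i
    rw [force, Finset.mul_sum]
    exact Finset.sum_congr rfl fun j _ => by rw [hφ]; ring
  have h2 : ∑ i, ∑ j, φ i j * pts V v j = - ∑ i, ∑ j, φ i j * pts V v i := by
    rw [Finset.sum_comm]
    simp only [← Finset.sum_neg_distrib]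
    exact Finset.sum_congr rfl fun i _ => Finset.sum_congr rfl fun j _ => by rw [hφ]; ring
  have h3 : ∑ i, force (cluster i) * pts V v i = 2 * ∑ i, ∑ j, φ i j * pts V v i := by
    simp only [h1, Finset.mul_sum, Finset.sum_mul]
    exact Finset.sum_congr rfl fun i _ => Finset.sum_congr rfl fun j _ => by ring
  calc _ = ∑ i, ∑ j, φ i j * pts V v i - ∑ i, ∑ j, φ i j * pts V v j := by
        simp only [← Finset.sum_sub_distrib]
        exact Finset.sum_congr rfl fun i _ => Finset.sum_congr rfl fun j _ => by rw [hφ]; ring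
    _ = _ := by rw [h2, h3]; ring

/-- Testing the gradient `G` against itself gives `‖G‖² = ∑ forceᵢ Gᵢ` in point coordinates.
Cauchy–Schwarz bounds `‖G‖` by the norm of the force vector, which does not involve `V`. -/
theorem IsCentering.norm_grad_approx (hV : IsCentering V) :
    ‖quarticGrad (rowDiff 1 V) sqDist (drop V (clusterConfig approxPos))‖ < 1.8 / 10 ^ 3 := by
  set G := quarticGrad (rowDiff 1 V) sqDist (drop V (clusterConfig approxPos)) with hG
  have h1 := hV.inner_grad_approx G
  rw [← hG, real_inner_self_eq_norm_sq] at h1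
  have h2 := Finset.sum_mul_sq_le_sq_mul_sq Finset.univ (fun i => force (cluster i)) (pts V G)
  rw [← h1, hV.sum_pts_sq] at h2
  have h3 := sum_force_sq_lt
  refine lt_of_pow_lt_pow_left₀ 2 (by positivity) ?_
  rcases (sq_nonneg ‖G‖).eq_or_lt with h0 | h0
  · rw [← h0]; positivity
  · refine lt_of_le_of_lt ?_ h3
    refine le_of_mul_le_mul_right ?_ h0
    rw [← sq]
    exact h2

theorem IsCentering.abs_pts_sub_le_of_mem_ball (hV : IsCentering V) {L : Config (50 - 1) 1}
    (hL : L ∈ Metric.ball (drop V (clusterConfig approxPos)) (1 / 10 ^ 3)) (i j : Fin 50) :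
    |pts V L i - pts V L j| ≤ 5 := by
  have h1 : ∀ b c : Fin 3, |approxPos b - approxPos c| ≤ 4.8 := by
    intro b c
    rw [abs_le]
    fin_cases b <;> fin_cases c <;> simp [approxPos] <;> norm_num
  have h2 := h1 (cluster i) (cluster j)
  rw [← hV.pts_drop_sub] at h2
  have h3 := hV.abs_pts_sub_le (L - drop V (clusterConfig approxPos)) i j
  rw [mem_ball_iff_norm] at hL
  rw [pts_sub, pts_sub] at h3
  rw [abs_le] at h2 h3 ⊢
  constructor <;> norm_num at * <;> linarith [h2.1, h2.2, h3.1, h3.2]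

/-- Differences of positions on the ball are at most `5`, so `R = 5 + 5` and the constant obtained
is `24 · 50 · 10 = 12000`, well below the prescribed one. -/
theorem IsCentering.lipschitz_approx (hV : IsCentering V) {y z : Config (50 - 1) 1}
    (hy : y ∈ Metric.ball (drop V (clusterConfig approxPos)) (1 / 10 ^ 3))
    (hz : z ∈ Metric.ball (drop V (clusterConfig approxPos)) (1 / 10 ^ 3)) :
    ‖quarticHess (rowDiff 1 V) sqDist y - quarticHess (rowDiff 1 V) sqDist z‖ ≤
      72500 * ‖y - z‖ := by
  refine (hV.norm_quarticHess_sub_le sqDist (R := 10) (by norm_num) fun i j => ?_).trans ?_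
  · have h1 := hV.abs_pts_sub_le_of_mem_ball hy i j
    have h2 := hV.abs_pts_sub_le_of_mem_ball hz i j
    have := abs_add_le (pts V y i - pts V y j) (pts V z i - pts V z j)
    linarith
  · gcongr
    norm_num

theorem IsCentering.lower_approx (hV : IsCentering V) {y : Config (50 - 1) 1}
    (hy : y ∈ Metric.ball (drop V (clusterConfig approxPos)) (1 / 10 ^ 3)) :
    10 ^ 3 < quartic (rowDiff 1 V) sqDist y := by
  -- The worst residual is between the large cluster and the single point, about `-11.24`.
  have ha : ∀ b c : Fin 3, -12 ≤ (approxPos b - approxPos c) ^ 2 -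
      (truePos b - truePos c) ^ 2 := by
    intro b c
    fin_cases b <;> fin_cases c <;> simp [approxPos, truePos] <;> norm_num
  have hq := hV.quartic_lower_bound (c := sqDist) (x := drop V (clusterConfig approxPos)) (a := 12)
    (fun p => by rw [hV.pts_drop_sub]; exact ha _ _) y
  have h1 := hV.quartic_approx
  have h2 := hV.norm_grad_approx
  have h4 := mem_ball_iff_norm.1 hy
  generalize ‖quarticGrad (rowDiff 1 V) sqDist (drop V (clusterConfig approxPos))‖ = G at *
  have h0 := norm_nonneg (y - drop V (clusterConfig approxPos))
  generalize ‖y - drop V (clusterConfig approxPos)‖ = h at *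
  have h5 : G * h ≤ 1 * 1 :=
    mul_le_mul (h2.le.trans (by norm_num)) (h4.le.trans (by norm_num)) h0 (by norm_num)
  have h6 : h ^ 2 ≤ (1 / 10 ^ 3) ^ 2 := by gcongr
  norm_num at *
  linarith

theorem IsCentering.isAdmissible_approx (hV : IsCentering V) :
    IsAdmissible (quartic (rowDiff 1 V) sqDist) (drop V (clusterConfig approxPos))
      (1 / 10 ^ 3) (10 ^ 3) 72500 :=
  isAdmissible_of_coercive (b := 300) (by norm_num) (by norm_num) (by norm_num) (by norm_num)
    hV.coercive_approx (fun _ hy _ hz => hV.lipschitz_approx hy hz)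
    (fun _ hy => hV.lower_approx hy)

end Witness

/-! ### Estimates for `α`, `r₀` and `r₁` from coercivity -/

section Radii

variable {E : Type*} [NormedAddCommGroup E] [InnerProductSpace ℝ E] [CompleteSpace E]

theorem lt_of_hasEigenvalue {g : E → ℝ} {x : E} {b : ℝ}
    (hco : ∀ v, b * ‖v‖ ^ 2 ≤ inner ℝ (hess g x v) v) {μ : ℝ}
    (hμ : Module.End.HasEigenvalue (hess g x : E →ₗ[ℝ] E) μ) : b ≤ μ := by
  obtain ⟨v, hv⟩ := hμ.exists_hasEigenvector
  have h1 : hess g x v = μ • v := hv.apply_eq_smul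
  have h2 := hco v
  rw [h1, real_inner_smul_left, real_inner_self_eq_norm_sq] at h2
  exact le_of_mul_le_mul_right h2 (pow_pos (norm_pos_iff.2 hv.2) 2)

variable [FiniteDimensional ℝ E]

theorem beta_le_of_coercive {g : E → ℝ} {x : E} {b : ℝ} (hb : 0 < b)
    (hco : ∀ v, b * ‖v‖ ^ 2 ≤ inner ℝ (hess g x v) v) : beta g x ≤ 1 / b := by
  refine ContinuousLinearMap.opNorm_le_bound _ (by positivity) fun y => ?_
  rw [one_div_mul_eq_div]
  exact norm_inverse_apply_le_of_coercive hb hco y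

variable [Nontrivial E]

/-- Coercivity gives `β ≤ 1/b` and `η ≤ ε/b`, hence `α ≤ γε/b²`. As `rTwo ≥ 1/(βγ)`, the product of
the roots forces `r₀ ≤ 2η`, and also `rTwo ≥ b/γ ≥ r`. -/
theorem IsAdmissible.radii {g : E → ℝ} {x : E} {r c γ b ε : ℝ} (h : IsAdmissible g x r c γ)
    (hb : 0 < b) (hco : ∀ v, b * ‖v‖ ^ 2 ≤ inner ℝ (hess g x v) v)
    (hε : ‖gradient g x‖ ≤ ε) (hα : 2 * γ * ε < b ^ 2) (hr : 2 * ε < b * r) (hγ : γ * r ≤ b) :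
    alpha g x γ < 1 / 2 ∧ rZero g x γ < r ∧ rOne g x r γ = r := by
  have hβ0 := h.beta_pos
  have hγ0 := h.gamma_pos
  have hβ := beta_le_of_coercive hb hco
  have hη : eta g x ≤ ε / b :=
    (norm_inverse_apply_le_of_coercive hb hco _).trans (by gcongr)
  have hη0 : 0 ≤ eta g x := norm_nonneg _
  have hα' : alpha g x γ < 1 / 2 := by
    calc alpha g x γ ≤ 1 / b * γ * (ε / b) := by unfold alpha; gcongr
      _ = (2 * γ * ε) / b ^ 2 / 2 := by field_simp
      _ < 1 / 2 := by
        gcongr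
        rwa [div_lt_one (by positivity)]
  obtain ⟨hs, hsw, hw, hsum, hprod⟩ := majorant_roots h hα'.le
  have hrad : 1 / (beta g x * γ) ≤ rTwo g x γ := by
    have : 2 / (beta g x * γ) = 2 * (1 / (beta g x * γ)) := by ring
    linarith
  refine ⟨hα', ?_, min_eq_left ?_⟩
  · have h1 : rZero g x γ * (1 / (beta g x * γ)) ≤ 2 * eta g x * (1 / (beta g x * γ)) := by
      rw [mul_one_div (2 * eta g x), ← hprod]
      gcongr
    have h2 := le_of_mul_le_mul_right h1 (by positivity)
    have h3 : 2 * (ε / b) < r := by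
      rw [mul_div_assoc', div_lt_iff₀ hb]
      linarith
    linarith
  · refine le_trans ?_ hrad
    rw [le_div_iff₀ (by positivity)]
    have h1 : beta g x * b ≤ 1 := by rwa [le_div_iff₀ hb] at hβ
    have := h.r_pos
    nlinarith

end Radii

/-- A local nonglobal minimizer of the smooth stress of fifty points on a line. -/
theorem exists_lngm_fifty (V : Matrix (Fin 50) (Fin (50 - 1)) ℝ) (hV : IsCentering V) :
      ∃ (Lbar Lt : Config (50 - 1) 1) (D : Matrix (Fin 50) (Fin 50) ℝ)
          (g : Config (50 - 1) 1 → ℝ),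
        D = edm (lift V Lbar) ∧
        g = fL V D ∧
        2.6 * 10 ^ 3 < g Lt ∧
        ‖gradient g Lt‖ < 1.8 / 10 ^ 3 ∧
        (∀ μ : ℝ, Module.End.HasEigenvalue
            (hess g Lt : Config (50 - 1) 1 →ₗ[ℝ]
              Config (50 - 1) 1) μ → 211 < μ) ∧
        2127.8 < sumDist (lift V Lt) ∧
        sumDist (lift V Lt) < 2127.9 ∧
        IsAdmissible g Lt (1 / 10 ^ 3) (10 ^ 3) 72500 ∧
        alpha g Lt 72500 < 1 / 2 ∧
        rZero g Lt 72500 < 1 / 10 ^ 3 ∧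
        rOne g Lt (1 / 10 ^ 3) 72500 = 1 / 10 ^ 3 ∧
        ∃ Ls ∈ Metric.ball Lt (1 / 10 ^ 3),
          Tendsto (newton g Lt) atTop (𝓝 Ls) ∧
          gradient g Ls = 0 ∧
          (∀ L ∈ Metric.closedBall Lt (1 / 10 ^ 3), gradient g L = 0 → L = Ls) ∧
          IsLngm g Ls ∧
          IsLngm (f D) (lift V Ls) := by
  set Lbar := drop V (clusterConfig truePos) with hLbar
  set Lt := drop V (clusterConfig approxPos) with hLt
  set D := edm (lift V Lbar) with hD
  set g := fL V D with hg
  have hgq : g = quartic (rowDiff 1 V) sqDist := hV.fL_truePos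
  have hval := hV.quartic_approx
  have hgrad := hV.norm_grad_approx
  have hco := hV.coercive_approx
  have hadm := hV.isAdmissible_approx
  rw [← gradient_quartic] at hgrad
  simp only [← hess_quartic] at hco
  rw [← hgq, ← hLt] at hval hgrad hadm
  simp only [← hgq, ← hLt] at hco
  have hnt := IsAdmissible.nontrivial hV hadm
  -- With `b = 300` and `ε = 0.0018` the three conditions read `261 < 90000`, `0.0036 < 0.3` and
  -- `72.5 ≤ 300`.
  obtain ⟨hα, hr0, hr1⟩ := hadm.radii (b := 300) (by norm_num) hco hgrad.le (by norm_num)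
    (by norm_num) (by norm_num)
  obtain ⟨-, Ls, hlim, hball, hzero, -, huniq, hlngm⟩ :=
    stress_newton 50 1 V (lift V Lbar) g Lt _ _ _ hV hg hadm hα.le hr0.le
  exact ⟨Lbar, Lt, D, g, rfl, rfl, hval, hgrad,
    fun μ hμ => lt_of_lt_of_le (by norm_num) (lt_of_hasEigenvalue hco hμ),
    hV.sumDist_approx.1, hV.sumDist_approx.2, hadm, hα, hr0, hr1, Ls,
    (Metric.mem_closedBall.1 hball).trans_lt hr0, hlim, hzero, huniq, hlngm,
    hV.isLngm_lift hlngm⟩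

end SmoothStress

end

theorem mainTheorem2 :
    (∀ (n d : ℕ) (V : Matrix (Fin n) (Fin (n - 1)) ℝ) (Pbar : SmoothStress.Config n d)
        (g : SmoothStress.Config (n - 1) d → ℝ)
        (Lt : SmoothStress.Config (n - 1) d) (r c γ : ℝ),
      SmoothStress.IsCentering V →
      SmoothStress.IsCentered Pbar →
      g = SmoothStress.fL V (SmoothStress.edm Pbar) →
      SmoothStress.IsAdmissible g Lt r c γ →
      SmoothStress.alpha g Lt γ ≤ 1 / 2 →
      SmoothStress.rZero g Lt γ ≤ r →
      (∀ k, (SmoothStress.hess g (SmoothStress.newton g Lt k)).IsInvertible) ∧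
      ∃ Ls : SmoothStress.Config (n - 1) d,
        Tendsto (SmoothStress.newton g Lt) atTop (𝓝 Ls) ∧
        Ls ∈ Metric.closedBall Lt (SmoothStress.rZero g Lt γ) ∧
        gradient g Ls = 0 ∧
        (∀ L ∈ Metric.closedBall Lt (SmoothStress.rZero g Lt γ), gradient g L = 0 → L = Ls) ∧
        (SmoothStress.alpha g Lt γ < 1 / 2 →
          Ls ∈ Metric.closedBall Lt (SmoothStress.rOne g Lt r γ) ∧
          (∀ L ∈ Metric.closedBall Lt (SmoothStress.rOne g Lt r γ),
            gradient g L = 0 → L = Ls) ∧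
          ∀ k : ℕ, ‖SmoothStress.newton g Lt k - Ls‖ ≤
            (2 * SmoothStress.alpha g Lt γ) ^ (2 ^ k) *
              (SmoothStress.eta g Lt / SmoothStress.alpha g Lt γ)) ∧
        SmoothStress.IsLngm g Ls) ∧
    (∀ V : Matrix (Fin 50) (Fin (50 - 1)) ℝ, SmoothStress.IsCentering V →
      ∃ (Lbar Lt : SmoothStress.Config (50 - 1) 1) (D : Matrix (Fin 50) (Fin 50) ℝ)
          (g : SmoothStress.Config (50 - 1) 1 → ℝ),
        D = SmoothStress.edm (SmoothStress.lift V Lbar) ∧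
        g = SmoothStress.fL V D ∧
        2.6 * 10 ^ 3 < g Lt ∧
        ‖gradient g Lt‖ < 1.8 / 10 ^ 3 ∧
        (∀ μ : ℝ, Module.End.HasEigenvalue
            (SmoothStress.hess g Lt : SmoothStress.Config (50 - 1) 1 →ₗ[ℝ]
              SmoothStress.Config (50 - 1) 1) μ → 211 < μ) ∧
        2127.8 < SmoothStress.sumDist (SmoothStress.lift V Lt) ∧
        SmoothStress.sumDist (SmoothStress.lift V Lt) < 2127.9 ∧
        SmoothStress.IsAdmissible g Lt (1 / 10 ^ 3) (10 ^ 3) 72500 ∧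
        SmoothStress.alpha g Lt 72500 < 1 / 2 ∧
        SmoothStress.rZero g Lt 72500 < 1 / 10 ^ 3 ∧
        SmoothStress.rOne g Lt (1 / 10 ^ 3) 72500 = 1 / 10 ^ 3 ∧
        ∃ Ls ∈ Metric.ball Lt (1 / 10 ^ 3),
          Tendsto (SmoothStress.newton g Lt) atTop (𝓝 Ls) ∧
          gradient g Ls = 0 ∧
          (∀ L ∈ Metric.closedBall Lt (1 / 10 ^ 3), gradient g L = 0 → L = Ls) ∧
          SmoothStress.IsLngm g Ls ∧
          SmoothStress.IsLngm (SmoothStress.f D) (SmoothStress.lift V Ls)) := by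
  refine ⟨fun n d V Pbar g Lt r c γ hV _ hg h hα hr => ?_, SmoothStress.exists_lngm_fifty⟩
  obtain ⟨hinv, Ls, hlim, hball, hzero, hrate, huniq, hlngm⟩ :=
    SmoothStress.stress_newton n d V Pbar g Lt r c γ hV hg h hα hr
  have hnt : Nontrivial (SmoothStress.Config (n - 1) d) := by
    subst hg
    exact h.nontrivial hV
  -- Both uniqueness claims are inherited from the closed ball of radius `r`, which contains the
  -- balls of radius `r₀` and `r₁`.
  refine ⟨hinv, Ls, hlim, hball, hzero,
    fun L hL => huniq L (Metric.closedBall_subset_closedBall hr hL), fun _ => ⟨?_, ?_, hrate⟩,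
    hlngm⟩
  · exact Metric.closedBall_subset_closedBall (SmoothStress.rZero_le_rOne h hα hr) hball
  · exact fun L hL => huniq L (Metric.closedBall_subset_closedBall (min_le_left _ _) hL)
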